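/- Let $N\ge 2$ be an integer, $0<\beta<1$, $N'=\frac{N}{N-1}$, let $\mathbb{B}_N$ be the open unit ball of $\mathbb{R}^N$ and $\omega_{N-1}$ the surface area of $\partial\mathbb{B}_N$. For $0<r<1$ put $$X_1(r)=\Big(\ln\frac{e}{r}\Big)^{-1},\qquad Y_1(r)=\Big(\ln\frac1r\Big)^{-1},$$ and write $X_1=X_1(|x|)$, $Y_1=Y_1(|x|)$. Let $w_{1\beta}(x)=Y_1(|x|)^{-\beta(N-1)}=\big(\ln\frac{1}{|x|}\big)^{\beta(N-1)}$ on $\mathbb{B}_N$ and $\|f\|_{N,w_{1\beta}}=\big(\int_{\mathbb{B}_N}|f|^N w_{1\beta}\,dx\big)^{1/N}$. Let $W^{1,N}_0(\mathbb{B}_N,w_{1\beta})$ be the closure of $C^1_c(\mathbb{B}_N)$ in the weighted Sobolev norm $\|u\|_{N,w_{1\beta}}+\|\nabla u\|_{N,w_{1\beta}}$ (with $\nabla u$ the weak gradient), and let $W^{1,N}_{0,rad}(\mathbb{B}_N,w_{1\beta})$ be the subspace of its radial functions. Set $$\alpha_{N,\beta}=N\,\omega_{N-1}^{\frac{1}{N-1}}(1-\beta).$$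 Theorem 1.7. For every $\alpha\in\mathbb{R}$, $$\sup_{\{u\in W^{1,N}_{0,rad}(\mathbb{B}_N,w_{1\beta})\,:\,\|\nabla u\|_{N,w_{1\beta}}\le 1\}}\ \frac{1}{|\mathbb{B}_N|}\int_{\mathbb{B}_N}e^{\alpha|u|^{N'}X_1^{-\beta}}\,dx<\infty\quad\text{if and only if}\quad \alpha\le\alpha_{N,\beta}.$$ Moreover, for every $\alpha>\alpha_{N,\beta}$, $$\sup_{\{u\in W^{1,N}_{0,rad}(\mathbb{B}_N,w_{1\beta})\,:\,\|\nabla u\|_{N,w_{1\beta}}\le 1\}}\ \frac{1}{|\mathbb{B}_N|}\int_{\mathbb{B}_N}e^{\alpha|u|^{N'}Y_1^{-\beta}}\,dx=\infty.$$ -/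

import Mathlib

open MeasureTheory Filter Topology
open scoped ENNReal ContDiff

noncomputable section

/-- The open unit ball of `ℝ^N`. -/
def unitBall (N : ℕ) : Set (EuclideanSpace ℝ (Fin N)) := Metric.ball 0 1

/-- The logarithmic factor `X₁(r) = (log (e / r))⁻¹`. -/
def X1 (r : ℝ) : ℝ := (Real.log (Real.exp 1 / r))⁻¹

/-- The logarithmic factor `Y₁(r) = (log (1 / r))⁻¹`. -/
def Y1 (r : ℝ) : ℝ := (Real.log (1 / r))⁻¹

/-- The weight `w_{1β}(x) = Y₁(|x|)^{-β(N-1)}`; it is only used on the unit ball. -/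
def weight1 (N : ℕ) (β : ℝ) (x : EuclideanSpace ℝ (Fin N)) : ℝ :=
  Y1 ‖x‖ ^ (-(β * ((N : ℝ) - 1)))

/-- The measure `w_{1β} dx` on the unit ball. -/
def weightedMeasure (N : ℕ) (β : ℝ) : Measure (EuclideanSpace ℝ (Fin N)) :=
  (volume.restrict (unitBall N)).withDensity fun x => ENNReal.ofReal (weight1 N β x)

/-- The weighted norm `‖f‖_{N,w_{1β}} = (∫_{𝔹_N} |f|^N w_{1β} dx)^{1/N}` of a scalar function or a
vector field. -/
def weightedNorm (N : ℕ) (β : ℝ) {F : Type*} [NormedAddCommGroup F]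
    (f : EuclideanSpace ℝ (Fin N) → F) : ℝ≥0∞ :=
  eLpNorm f (N : ℝ≥0∞) (weightedMeasure N β)

/-- `φ ∈ C¹_c(𝔹_N)`. -/
def IsC1c (N : ℕ) (φ : EuclideanSpace ℝ (Fin N) → ℝ) : Prop :=
  ContDiff ℝ 1 φ ∧ HasCompactSupport φ ∧ tsupport φ ⊆ unitBall N

/-- `g` is the weak (distributional) gradient of `u` on the unit ball. -/
structure HasWeakGradient (N : ℕ) (u : EuclideanSpace ℝ (Fin N) → ℝ)
    (g : EuclideanSpace ℝ (Fin N) → EuclideanSpace ℝ (Fin N)) : Prop where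
  locallyIntegrable_fun : LocallyIntegrableOn u (unitBall N)
  locallyIntegrable_grad : LocallyIntegrableOn g (unitBall N)
  integral_eq : ∀ ψ : EuclideanSpace ℝ (Fin N) → ℝ, ContDiff ℝ ∞ ψ → HasCompactSupport ψ →
    tsupport ψ ⊆ unitBall N → ∀ v : EuclideanSpace ℝ (Fin N),
      ∫ x in unitBall N, u x * fderiv ℝ ψ x v = -∫ x in unitBall N, inner ℝ (g x) v * ψ x

/-- `u ∈ W₀^{1,N}(𝔹_N, w_{1β})` with weak gradient `∇u = g`: the pair `(u, ∇u)` is the limit, in the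
weighted norm, of pairs `(φ, ∇φ)` with `φ ∈ C¹_c(𝔹_N)`. -/
structure MemW0 (N : ℕ) (β : ℝ) (u : EuclideanSpace ℝ (Fin N) → ℝ)
    (g : EuclideanSpace ℝ (Fin N) → EuclideanSpace ℝ (Fin N)) : Prop where
  hasWeakGradient : HasWeakGradient N u g
  exists_approx : ∃ φ : ℕ → EuclideanSpace ℝ (Fin N) → ℝ, (∀ n, IsC1c N (φ n)) ∧
    Tendsto (fun n => weightedNorm N β fun x => φ n x - u x) atTop (𝓝 0) ∧
    Tendsto (fun n => weightedNorm N β fun x => gradient (φ n) x - g x) atTop (𝓝 0)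

/-- `u` is radial on the unit ball (as an almost everywhere class). -/
def IsRadial (N : ℕ) (u : EuclideanSpace ℝ (Fin N) → ℝ) : Prop :=
  ∃ f : ℝ → ℝ, ∀ᵐ x ∂(volume.restrict (unitBall N)), u x = f ‖x‖

/-- The radial functions `u ∈ W₀^{1,N}(𝔹_N, w_{1β})` with `‖∇u‖_{N,w_{1β}} ≤ 1`. -/
def admissible (N : ℕ) (β : ℝ) : Set (EuclideanSpace ℝ (Fin N) → ℝ) :=
  {u | IsRadial N u ∧ ∃ g, MemW0 N β u g ∧ weightedNorm N β g ≤ 1}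

/-- The supremum, over the radial functions with `‖∇u‖_{N,w_{1β}} ≤ 1`, of the mean over the unit
ball of `exp (α |u|^{N'} Z(|x|)^{-β})`, where `N' = N / (N - 1)`. -/
def moserSup (N : ℕ) (β α : ℝ) (Z : ℝ → ℝ) : ℝ≥0∞ :=
  ⨆ u ∈ admissible N β, ⨍⁻ x in unitBall N,
    ENNReal.ofReal (Real.exp (α * |u x| ^ ((N : ℝ) / ((N : ℝ) - 1)) * Z ‖x‖ ^ (-β))) ∂volume

/-- The surface area `ω_{N-1}` of the unit sphere of `ℝ^N`. -/
def surfaceArea (N : ℕ) : ℝ :=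
  (volume : Measure (EuclideanSpace ℝ (Fin N))).toSphere.real Set.univ

/-- The critical exponent `α_{N,β} = N ω_{N-1}^{1/(N-1)} (1 - β)`. -/
def criticalExponent (N : ℕ) (β : ℝ) : ℝ :=
  N * surfaceArea N ^ (1 / ((N : ℝ) - 1)) * (1 - β)

end

/-- The two-term Hölder (Radon) inequality. -/
theorem add_pow_succ_le_radon (n : ℕ) {a b x y : ℝ} (ha : 0 ≤ a) (hb : 0 ≤ b) (hx : 0 < x)
    (hy : 0 < y) :
    (a + b) ^ (n + 1) ≤ (x + y) ^ n * (a ^ (n + 1) / x ^ n + b ^ (n + 1) / y ^ n) := by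
  have hxy : 0 < x + y := by positivity
  have h := (convexOn_pow (n + 1)).2 (show a / x ∈ Set.Ici (0 : ℝ) by simp; positivity)
    (show b / y ∈ Set.Ici (0 : ℝ) by simp; positivity)
    (show (0 : ℝ) ≤ x / (x + y) by positivity) (show (0 : ℝ) ≤ y / (x + y) by positivity)
    (by field_simp)
  simp only [smul_eq_mul] at h
  have e1 : x / (x + y) * (a / x) + y / (x + y) * (b / y) = (a + b) / (x + y) := by
    field_simp
  rw [e1, div_pow, div_le_iff₀ (by positivity)] at h
  refine h.trans (le_of_eq ?_)
  rw [div_pow, div_pow]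
  field_simp
  ring

/-- Moser's gap estimate: if an increment inequality of Hölder type holds and both values are
within `l` of the extremal growth, then the two points are at distance `O(l)`. -/
theorem moser_gap {n : ℕ} (hn : 1 ≤ n) {s d l y z : ℝ} (hs : 0 < s) (hd : 0 ≤ d) (hl : 0 ≤ l)
    (hy : 0 ≤ y)
    (h : y ^ (n + 1) / s ^ n + |z - y| ^ (n + 1) / d ^ n ≤ 1)
    (h1 : (s - l) ^ n ≤ y ^ (n + 1)) (h2 : (s + d - l) ^ n ≤ |z| ^ (n + 1))
    (hM : 2 ^ (n + 1) * n * l ≤ s) :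
    d ≤ 4 * (1 + 2 ^ (n + 1) * n) * l := by
  rcases hd.eq_or_lt with rfl | hd
  · positivity
  have hn' : (1 : ℝ) ≤ n := by exact_mod_cast hn
  have h2n : (2 : ℝ) ≤ 2 ^ (n + 1) := by
    rw [pow_succ]; linarith [one_le_pow₀ (one_le_two : (1 : ℝ) ≤ 2) (n := n)]
  have hls : l ≤ s := by
    refine le_trans ?_ hM
    have : (1 : ℝ) ≤ 2 ^ (n + 1) * n := by nlinarith
    nlinarith
  set ε : ℝ := |z - y| ^ (n + 1) / d ^ n with hε
  have hε0 : 0 ≤ ε := by positivity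
  have hε1 : ε ≤ n * (l / s) := by
    have hb : 1 + (n : ℝ) * (-(l / s)) ≤ (1 + -(l / s)) ^ n := by
      apply one_add_mul_le_pow
      have : l / s ≤ 1 := (div_le_one hs).2 hls
      linarith
    have : (1 + -(l / s)) ^ n ≤ y ^ (n + 1) / s ^ n := by
      rw [le_div_iff₀ (by positivity), ← mul_pow]
      refine le_trans (le_of_eq ?_) h1
      congr 1
      field_simp
      ring
    linarith
  have hz : |z| ≤ y + |z - y| := by
    have := abs_add_le y (z - y)
    rwa [add_sub_cancel, abs_of_nonneg hy] at this
  have hr := add_pow_succ_le_radon n hy (abs_nonneg (z - y)) hs (half_pos hd)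
  have hr2 : |z - y| ^ (n + 1) / (d / 2) ^ n = 2 ^ n * ε := by
    rw [hε, div_pow]
    field_simp
  rw [hr2] at hr
  have hone : (1 : ℝ) ≤ 1 + 2 ^ n * ε := by
    have : 0 ≤ 2 ^ n * ε := by positivity
    linarith
  have hkey : (s + d - l) ^ n ≤ ((s + d / 2) * (1 + 2 ^ n * ε)) ^ n := by
    calc (s + d - l) ^ n ≤ |z| ^ (n + 1) := h2
      _ ≤ (y + |z - y|) ^ (n + 1) := by gcongr
      _ ≤ _ := hr
      _ ≤ (s + d / 2) ^ n * (1 + 2 ^ n * ε) := by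
        gcongr
        linarith
      _ ≤ (s + d / 2) ^ n * (1 + 2 ^ n * ε) ^ n := by
        gcongr
        exact le_self_pow₀ hone (by omega)
      _ = _ := by rw [mul_pow]
  have hle : s + d - l ≤ (s + d / 2) * (1 + 2 ^ n * ε) :=
    le_of_pow_le_pow_left₀ (by omega) (by positivity) hkey
  have hA : s * (2 ^ n * ε) ≤ 2 ^ (n + 1) * n * l := by
    calc s * (2 ^ n * ε) ≤ s * (2 ^ n * (n * (l / s))) := by gcongr
      _ = 2 ^ n * n * l := by field_simp
      _ ≤ 2 ^ (n + 1) * n * l := by gcongr <;> simp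
  have hB : 2 ^ n * ε ≤ 1 / 2 := by
    have : 2 ^ n * ε ≤ 2 ^ n * (n * (l / s)) := by gcongr
    refine this.trans ?_
    have : 2 ^ n * (n * (l / s)) = (2 ^ (n + 1) * n * l) / s / 2 := by
      rw [pow_succ]; field_simp
    rw [this]
    have := (div_le_one hs).2 hM
    linarith
  have hC : d / 2 * (2 ^ n * ε) ≤ d / 2 * (1 / 2) := by gcongr
  nlinarith

/-- The gap estimate in the logarithmic variable `t`, where `s = t ^ (1 - β)`. -/
theorem moser_gap_weighted {n : ℕ} (hn : 1 ≤ n) {β : ℝ} (hβ₀ : 0 < β) (hβ₁ : β < 1) :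
    ∃ C : ℝ, 0 < C ∧ ∀ t r l y z : ℝ, 0 < t → t ≤ r → 0 ≤ l → 0 ≤ y → 0 ≤ z →
      y ^ (n + 1) / (t ^ (1 - β)) ^ n
        + |z - y| ^ (n + 1) / (r ^ (1 - β) - t ^ (1 - β)) ^ n ≤ 1 →
      t - l ≤ t ^ β * y ^ (((n : ℝ) + 1) / n) → r - l ≤ r ^ β * z ^ (((n : ℝ) + 1) / n) →
      2 ^ (n + 1) * n * l < t → r - t ≤ C * l := by
  have hn' : (1 : ℝ) ≤ n := by exact_mod_cast hn
  have h2n : (2 : ℝ) ≤ 2 ^ (n + 1) := by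
    rw [pow_succ]; linarith [one_le_pow₀ (one_le_two : (1 : ℝ) ≤ 2) (n := n)]
  set M : ℝ := 2 ^ (n + 1) * n with hMdef
  have hM1 : 1 ≤ M := by nlinarith
  set K : ℝ := 4 * (1 + M) with hK
  set B : ℝ := ((9 : ℝ) ^ (1 - β)⁻¹) ^ β with hB
  have hB0 : 0 < B := by positivity
  have hβ' : 0 < 1 - β := by linarith
  refine ⟨K * B / (1 - β), by positivity, ?_⟩
  intro t r l y z ht htr hl hy hz h h1 h2 hMl
  have hr : 0 < r := ht.trans_le htr
  have hpow : ∀ x : ℝ, 0 ≤ x → (x ^ (((n : ℝ) + 1) / n)) ^ n = x ^ (n + 1) := by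
    intro x hx
    rw [← Real.rpow_natCast, ← Real.rpow_mul hx, div_mul_cancel₀ _ (by positivity)]
    exact_mod_cast Real.rpow_natCast x (n + 1)
  have hlt : l ≤ t := by nlinarith
  have htβ : 0 < t ^ β := by positivity
  have hsub : ∀ x v : ℝ, t ≤ x → 0 ≤ v → x - l ≤ x ^ β * v ^ (((n : ℝ) + 1) / n) →
      (x ^ (1 - β) - l / t ^ β) ^ n ≤ v ^ (n + 1) := by
    intro x v hx hv hxv
    have hx0 : 0 < x := ht.trans_le hx
    have hxβ : 0 < x ^ β := by positivity
    have hxx : x ^ (1 - β) = x / x ^ β := by rw [Real.rpow_sub hx0, Real.rpow_one]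
    have hle : l / x ^ β ≤ l / t ^ β := by gcongr
    rw [← hpow v hv]
    have hle2 : x ^ (1 - β) - l / x ^ β ≤ v ^ (((n : ℝ) + 1) / n) := by
      rw [hxx, ← sub_div, div_le_iff₀ hxβ]; linarith
    have hmon : t ^ (1 - β) ≤ x ^ (1 - β) := by gcongr
    have htt : t ^ (1 - β) = t / t ^ β := by rw [Real.rpow_sub ht, Real.rpow_one]
    have hnn : 0 ≤ t ^ (1 - β) - l / t ^ β := by
      rw [htt, ← sub_div]; apply div_nonneg _ htβ.le; linarith
    apply pow_le_pow_left₀ <;> linarith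
  have htt : t ^ (1 - β) = t / t ^ β := by rw [Real.rpow_sub ht, Real.rpow_one]
  have hrr : r ^ (1 - β) = r / r ^ β := by rw [Real.rpow_sub hr, Real.rpow_one]
  have hs1 : 0 < t ^ (1 - β) := by positivity
  have hgap := moser_gap hn (s := t ^ (1 - β)) (d := r ^ (1 - β) - t ^ (1 - β)) (l := l / t ^ β)
    (y := y) (z := z) hs1 (by rw [sub_nonneg]; gcongr) (by positivity) hy h
    (hsub t y le_rfl hy h1)
    (by rw [add_sub_cancel, abs_of_nonneg hz]; exact hsub r z htr hz h2)
    (by rw [htt, ← mul_div_assoc]; gcongr)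
  rw [← hMdef, ← hK] at hgap
  have hτ : (r / t) ^ (1 - β) ≤ 9 := by
    rw [Real.div_rpow hr.le ht.le, div_le_iff₀ hs1]
    have : K * (l / t ^ β) ≤ 8 * t ^ (1 - β) := by
      rw [htt, ← mul_div_assoc, ← mul_div_assoc]
      have : K * l ≤ 8 * t := by rw [hK]; linarith
      gcongr
    linarith
  have hτ2 : r / t ≤ 9 ^ (1 - β)⁻¹ := by
    have := Real.rpow_le_rpow (by positivity) hτ (inv_nonneg.2 hβ'.le)
    rwa [← Real.rpow_mul (by positivity), mul_inv_cancel₀ hβ'.ne', Real.rpow_one] at this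
  have hτ3 : r ^ β ≤ B * t ^ β := by
    have := Real.rpow_le_rpow (by positivity) hτ2 hβ₀.le
    rwa [Real.div_rpow hr.le ht.le, div_le_iff₀ htβ] at this
  have hbern : (t / r) ^ (1 - β) ≤ 1 + (1 - β) * (t / r - 1) := by
    have := rpow_one_add_le_one_add_mul_self (s := t / r - 1) (p := 1 - β)
      (by have : 0 ≤ t / r := by positivity
          linarith) hβ'.le (by linarith)
    rwa [add_sub_cancel] at this
  have hconc : (1 - β) * (r - t) ≤ r ^ β * (r ^ (1 - β) - t ^ (1 - β)) := by
    have h0 : t ^ (1 - β) = (t / r) ^ (1 - β) * (r / r ^ β) := by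
      rw [← hrr, Real.div_rpow ht.le hr.le]; field_simp
    have h3 : r ^ β * (r ^ (1 - β) - t ^ (1 - β)) = r * (1 - (t / r) ^ (1 - β)) := by
      rw [h0, hrr]; field_simp
    rw [h3]
    have h4 : (1 - β) * (r - t) = r * ((1 - β) * (1 - t / r)) := by field_simp
    rw [h4]
    gcongr
    linarith
  rw [div_mul_eq_mul_div, le_div_iff₀ hβ', mul_comm]
  calc (1 - β) * (r - t) ≤ r ^ β * (r ^ (1 - β) - t ^ (1 - β)) := hconc
    _ ≤ (B * t ^ β) * (K * (l / t ^ β)) := by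
      gcongr
      rw [sub_nonneg]; gcongr
    _ = K * B * l := by field_simp

/-- Sublevel sets of the Moser deficit `t - t ^ β * y t ^ (N / (N - 1))` have linearly bounded
size. -/
theorem exists_moser_sublevel_subset {n : ℕ} (hn : 1 ≤ n) {β : ℝ} (hβ₀ : 0 < β) (hβ₁ : β < 1) :
    ∃ C : ℝ, 0 < C ∧ ∀ (S : Set ℝ) (y : ℝ → ℝ), S ⊆ Set.Ioi 0 → (∀ t, 0 ≤ y t) →
      (∀ t ∈ S, ∀ r ∈ S, t ≤ r → y t ^ (n + 1) / (t ^ (1 - β)) ^ n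
        + |y r - y t| ^ (n + 1) / (r ^ (1 - β) - t ^ (1 - β)) ^ n ≤ 1) →
      ∀ l : ℝ, 0 ≤ l → ∃ t₀ : ℝ,
        {t ∈ S | t - t ^ β * y t ^ (((n : ℝ) + 1) / n) ≤ l} ⊆
          Set.Icc 0 (C * l) ∪ Set.Icc (t₀ - C * l) (t₀ + C * l) := by
  obtain ⟨C, hC, h⟩ := moser_gap_weighted hn hβ₀ hβ₁
  refine ⟨max C (2 ^ (n + 1) * n), by positivity, ?_⟩
  intro S y hS hy hpair l hl
  have hC1 : C * l ≤ max C (2 ^ (n + 1) * n) * l := by gcongr; exact le_max_left _ _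
  have hC2 : 2 ^ (n + 1) * n * l ≤ max C (2 ^ (n + 1) * n) * l := by gcongr; exact le_max_right _ _
  by_cases hne : ∃ t₀ ∈ S, t₀ - t₀ ^ β * y t₀ ^ (((n : ℝ) + 1) / n) ≤ l ∧
      2 ^ (n + 1) * n * l < t₀
  · obtain ⟨t₀, ht₀, h₀, hM₀⟩ := hne
    refine ⟨t₀, ?_⟩
    rintro t ⟨ht, htl⟩
    by_cases hM : 2 ^ (n + 1) * n * l < t
    · right
      rcases le_total t t₀ with hle | hle
      · have := h t t₀ l (y t) (y t₀) (hS ht) hle hl (hy _) (hy _) (hpair _ ht _ ht₀ hle)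
          (by linarith) (by linarith) hM
        constructor <;> linarith
      · have := h t₀ t l (y t₀) (y t) (hS ht₀) hle hl (hy _) (hy _) (hpair _ ht₀ _ ht hle)
          (by linarith) (by linarith) hM₀
        constructor <;> linarith
    · left
      exact ⟨(hS ht).le, by linarith⟩
  · push Not at hne
    refine ⟨0, ?_⟩
    rintro t ⟨ht, htl⟩
    left
    exact ⟨(hS ht).le, (hne t ht htl).trans hC2⟩

/-- Nonnegativity of the Moser deficit. -/
theorem moser_deficit_nonneg {n : ℕ} (hn : 1 ≤ n) {β t y : ℝ} (ht : 0 < t) (hy : 0 ≤ y)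
    (h : y ^ (n + 1) / (t ^ (1 - β)) ^ n ≤ 1) :
    t ^ β * y ^ (((n : ℝ) + 1) / n) ≤ t := by
  have hn' : (1 : ℝ) ≤ n := by exact_mod_cast hn
  have hpow : (y ^ (((n : ℝ) + 1) / n)) ^ n = y ^ (n + 1) := by
    rw [← Real.rpow_natCast, ← Real.rpow_mul hy, div_mul_cancel₀ _ (by positivity)]
    exact_mod_cast Real.rpow_natCast y (n + 1)
  rw [div_le_one (by positivity), ← hpow] at h
  have := le_of_pow_le_pow_left₀ (by omega) (by positivity) h
  rw [Real.rpow_sub ht, Real.rpow_one, le_div_iff₀ (by positivity)] at this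
  linarith

/-- The Euclidean space `ℝ^(n+1)`. -/
abbrev Eu (n : ℕ) : Type := EuclideanSpace ℝ (Fin (n + 1))

/-- The surface measure on the unit sphere of `ℝ^(n+1)`. -/
noncomputable abbrev sphereMeasure (n : ℕ) : Measure (Metric.sphere (0 : Eu n) 1) :=
  (volume : Measure (Eu n)).toSphere

/-- Polar coordinates for the Lebesgue integral in `ℝ^(n+1)`. -/
theorem lintegral_polar {n : ℕ} {F : Eu n → ℝ≥0∞} (hF : Measurable F) :
    ∫⁻ x, F x = ∫⁻ θ, (∫⁻ r in Set.Ioi (0 : ℝ), ENNReal.ofReal (r ^ n) * F (r • θ.1))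
      ∂(sphereMeasure n) := by
  have hmp := (volume : Measure (Eu n)).measurePreserving_homeomorphUnitSphereProd
  have hdim : Module.finrank ℝ (Eu n) - 1 = n := by simp
  rw [hdim] at hmp
  have hG : Measurable fun p : Metric.sphere (0 : Eu n) 1 × Set.Ioi (0 : ℝ) => F (p.2.1 • p.1.1) := by
    apply hF.comp; fun_prop
  calc ∫⁻ x, F x = ∫⁻ x in ({0}ᶜ : Set (Eu n)), F x := by rw [restrict_compl_singleton]
    _ = ∫⁻ x : ({0}ᶜ : Set (Eu n)), F x.1 ∂((volume : Measure (Eu n)).comap Subtype.val) :=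
        (lintegral_subtype_comap (measurableSet_singleton _).compl F).symm
    _ = ∫⁻ p, F (p.2.1 • p.1.1) ∂((sphereMeasure n).prod (.volumeIoiPow n)) := by
        rw [← hmp.lintegral_comp hG]
        refine lintegral_congr fun x => ?_
        congr 1
        have := congrArg Subtype.val ((homeomorphUnitSphereProd (Eu n)).symm_apply_apply x)
        rw [homeomorphUnitSphereProd_symm_apply_coe] at this
        exact this.symm
    _ = ∫⁻ θ, (∫⁻ r : Set.Ioi (0 : ℝ), F (r.1 • θ.1) ∂(.volumeIoiPow n)) ∂(sphereMeasure n) :=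
        lintegral_prod _ hG.aemeasurable
    _ = _ := by
        refine lintegral_congr fun θ => ?_
        rw [Measure.volumeIoiPow, lintegral_withDensity_eq_lintegral_mul _ (by fun_prop)
          (by apply hF.comp; fun_prop)]
        exact lintegral_subtype_comap measurableSet_Ioi
          (fun r : ℝ => ENNReal.ofReal (r ^ n) * F (r • θ.1))

/-- Polar coordinates, integrating over the sphere first. -/
theorem lintegral_polar_swap {n : ℕ} {F : Eu n → ℝ≥0∞}
    (hF : Measurable F) :
    ∫⁻ x, F x = ∫⁻ r in Set.Ioi (0 : ℝ), (∫⁻ θ, ENNReal.ofReal (r ^ n) * F (r • θ.1)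
      ∂(sphereMeasure n)) := by
  rw [lintegral_polar hF]
  apply lintegral_lintegral_swap
  apply Measurable.aemeasurable
  apply Measurable.mul (by fun_prop)
  apply hF.comp
  fun_prop

/-- The integral of a radial function. -/
theorem lintegral_norm_eq {n : ℕ} {F : ℝ → ℝ≥0∞} (hF : Measurable F) :
    ∫⁻ x : Eu n, F ‖x‖ =
      (sphereMeasure n) Set.univ *
        ∫⁻ r in Set.Ioi (0 : ℝ), ENNReal.ofReal (r ^ n) * F r := by
  rw [lintegral_polar (F := fun x : Eu n => F ‖x‖) (hF.comp measurable_norm), mul_comm, ← lintegral_const]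
  refine lintegral_congr fun θ => ?_
  refine setLIntegral_congr_fun measurableSet_Ioi fun r hr => ?_
  have : ‖θ.1‖ = 1 := by simp
  simp [norm_smul, this, abs_of_pos (Set.mem_Ioi.1 hr)]

theorem ae_ae_sphere_of_ae {n : ℕ} {P : Eu n → Prop}
    (h : ∀ᵐ x, P x) :
    ∀ᵐ r ∂(volume.restrict (Set.Ioi (0 : ℝ))),
      ∀ᵐ θ ∂(sphereMeasure n), P (r • θ.1) := by
  set S : Set (Eu n) := toMeasurable volume {x | ¬ P x}
  have hS : MeasurableSet S := measurableSet_toMeasurable _ _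
  have h0 : ∫⁻ x, S.indicator (fun _ => (1 : ℝ≥0∞)) x = 0 := by
    rw [lintegral_indicator_const hS, measure_toMeasurable, ae_iff.1 h, mul_zero]
  have hm : Measurable (S.indicator (fun _ => (1 : ℝ≥0∞))) := measurable_const.indicator hS
  have hm2 : Measurable fun p : ℝ × Metric.sphere (0 : Eu n) 1 =>
      ENNReal.ofReal (p.1 ^ n) * S.indicator (fun _ => (1 : ℝ≥0∞)) (p.1 • p.2.1) := by
    apply Measurable.mul (by fun_prop)
    apply hm.comp
    fun_prop
  rw [lintegral_polar_swap hm, lintegral_eq_zero_iff (Measurable.lintegral_prod_right hm2)] at h0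
  filter_upwards [h0, ae_restrict_mem measurableSet_Ioi] with r hr hr0
  have hr' := (lintegral_eq_zero_iff (hm2.comp measurable_prodMk_left)).1 hr
  filter_upwards [hr'] with θ hθ
  by_contra hP
  have hmem : r • θ.1 ∈ S := subset_toMeasurable _ _ hP
  have : 0 < r ^ n := pow_pos hr0 n
  simp [hmem] at hθ
  linarith

theorem ae_norm_of_ae {n : ℕ} {P : ℝ → Prop} (h : ∀ᵐ r ∂(volume.restrict (Set.Ioi (0 : ℝ))), P r) :
    ∀ᵐ x : Eu n, P ‖x‖ := by
  set S : Set ℝ := toMeasurable (volume.restrict (Set.Ioi (0 : ℝ))) {x | ¬ P x}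
  have hS : MeasurableSet S := measurableSet_toMeasurable _ _
  have hm : Measurable (S.indicator (fun _ => (1 : ℝ≥0∞))) := measurable_const.indicator hS
  have h0 : ∫⁻ x : Eu n, S.indicator (fun _ => (1 : ℝ≥0∞)) ‖x‖ = 0 := by
    rw [lintegral_norm_eq hm]
    have hz : ∀ᵐ r ∂(volume.restrict (Set.Ioi (0 : ℝ))), r ∉ S := by
      rw [ae_iff]
      simp only [not_not, Set.ofPred_mem_eq]
      rw [measure_toMeasurable]
      exact ae_iff.1 h
    rw [lintegral_eq_zero_of_ae_eq_zero, mul_zero]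
    filter_upwards [hz] with r hr
    simp [hr]
  replace h0 := (lintegral_eq_zero_iff (hm.comp measurable_norm)).1 h0
  filter_upwards [h0] with x hx
  by_contra hP
  have hmem : ‖x‖ ∈ S := subset_toMeasurable _ _ hP
  simp [hmem] at hx

theorem toSphere_univ_eq {n : ℕ} :
    (sphereMeasure n) Set.univ =
      ENNReal.ofReal (surfaceArea (n + 1)) := by
  rw [surfaceArea, ofReal_measureReal]

theorem surfaceArea_pos (n : ℕ) : 0 < surfaceArea (n + 1) := by
  rw [surfaceArea, measureReal_def]
  refine ENNReal.toReal_pos ?_ (measure_ne_top _ _)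
  rw [Measure.measure_univ_ne_zero]
  exact Measure.toSphere_ne_zero _

theorem log_one_div_eq_neg {r : ℝ} : Real.log (1 / r) = -Real.log r := by
  rw [one_div, Real.log_inv]

theorem weight1_eq {n : ℕ} {β : ℝ} {x : Eu n} (hx : ‖x‖ < 1) :
    weight1 (n + 1) β x = (-Real.log ‖x‖) ^ (β * n) := by
  have h0 : 0 ≤ -Real.log ‖x‖ := by
    have := Real.log_nonpos (norm_nonneg x) hx.le
    linarith
  rw [weight1, Y1, log_one_div_eq_neg, Real.inv_rpow h0, Real.rpow_neg h0, inv_inv]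
  push_cast
  simp

theorem measurable_weight1 {n : ℕ} {β : ℝ} : Measurable (weight1 n β) := by
  unfold weight1 Y1
  fun_prop

theorem weightedNorm_pow_eq {n : ℕ} {β : ℝ} {F : Type*} [NormedAddCommGroup F]
    (f : Eu n → F) :
    weightedNorm (n + 1) β f ^ (n + 1) =
      ∫⁻ x, ‖f x‖ₑ ^ (n + 1) ∂(weightedMeasure (n + 1) β) := by
  rw [weightedNorm, eLpNorm_eq_lintegral_rpow_enorm_toReal (by simp) (by simp)]
  rw [← ENNReal.rpow_natCast, ← ENNReal.rpow_mul]
  have h : ((n : ℝ) + 1) ≠ 0 := by positivity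
  have h' : (((n + 1 : ℕ) : ℝ≥0∞)).toReal = (n : ℝ) + 1 := by
    rw [ENNReal.toReal_natCast]; push_cast; rfl
  rw [h', Nat.cast_add_one, one_div, inv_mul_cancel₀ h, ENNReal.rpow_one]
  refine lintegral_congr fun x => ?_
  exact_mod_cast ENNReal.rpow_natCast _ (n + 1)

/-- The weighted integral of a function over the ball, in polar coordinates. -/
theorem lintegral_weightedMeasure_polar {n : ℕ} {β : ℝ}
    {G : Eu n → ℝ≥0∞} (hG : Measurable G) :
    ∫⁻ x, G x ∂(weightedMeasure (n + 1) β) =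
      ∫⁻ θ, (∫⁻ r in Set.Ioo (0 : ℝ) 1,
        ENNReal.ofReal (r ^ n * (-Real.log r) ^ (β * n)) * G (r • θ.1))
      ∂(sphereMeasure n) := by
  have hw : Measurable fun x => ENNReal.ofReal (weight1 (n + 1) β x) :=
    measurable_weight1.ennreal_ofReal
  have hb : MeasurableSet (unitBall (n + 1)) := Metric.isOpen_ball.measurableSet
  rw [weightedMeasure, lintegral_withDensity_eq_lintegral_mul _ hw hG,
    ← lintegral_indicator hb, lintegral_polar ((hw.mul hG).indicator hb)]
  refine lintegral_congr fun θ => ?_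
  have hθ : ‖θ.1‖ = 1 := by simp
  rw [← lintegral_indicator measurableSet_Ioi, ← lintegral_indicator measurableSet_Ioo]
  refine lintegral_congr fun r => ?_
  by_cases hr : 0 < r
  · have hn : ‖r • θ.1‖ = r := by simp [norm_smul, hθ, abs_of_pos hr]
    by_cases hr1 : r < 1
    · have hmem : r • θ.1 ∈ unitBall (n + 1) := by simp [unitBall, hn, hr1]
      rw [Set.indicator_of_mem (by exact hr), Set.indicator_of_mem hmem,
        Set.indicator_of_mem (by exact ⟨hr, hr1⟩), Pi.mul_apply, weight1_eq (by rw [hn]; exact hr1), hn,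
        ENNReal.ofReal_mul (by positivity), mul_assoc]
    · have hmem : r • θ.1 ∉ unitBall (n + 1) := by simp [unitBall, hn]; linarith
      rw [Set.indicator_of_mem (by exact hr), Set.indicator_of_notMem hmem, mul_zero,
        Set.indicator_of_notMem (by exact fun h => hr1 h.2)]
  · rw [Set.indicator_of_notMem (by exact hr),
      Set.indicator_of_notMem (by exact fun h => hr h.1)]

theorem hasDerivAt_neg_log_rpow {β : ℝ} (hβ₁ : β < 1) {r : ℝ} (h0 : 0 < r) (h1 : r < 1) :
    HasDerivAt (fun r => -(-Real.log r) ^ (1 - β) / (1 - β)) ((-Real.log r) ^ (-β) / r) r := by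
  have hl : 0 < -Real.log r := by linarith [Real.log_neg h0 h1]
  have h := ((((Real.hasDerivAt_log h0.ne').neg).rpow_const (p := 1 - β) (Or.inl hl.ne')).neg).div_const
    (1 - β)
  refine h.congr_deriv ?_
  have : 1 - β ≠ 0 := by linarith
  rw [show 1 - β - 1 = -β by ring]
  simp only [Pi.neg_apply]
  field_simp

theorem continuousOn_neg_log_rpow_div {β : ℝ} {a b : ℝ} (ha : 0 < a) (hb : b < 1) :
    ContinuousOn (fun r => (-Real.log r) ^ (-β) / r) (Set.Icc a b) := by
  intro r hr
  have h0 : 0 < r := ha.trans_le hr.1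
  have hl : 0 < -Real.log r := by linarith [Real.log_neg h0 (hr.2.trans_lt hb)]
  apply ContinuousAt.continuousWithinAt
  exact ((Real.continuousAt_log h0.ne').neg.rpow_const (Or.inl hl.ne')).div continuousAt_id h0.ne'

theorem integral_neg_log_rpow_div {β : ℝ} (hβ₁ : β < 1) {a b : ℝ} (ha : 0 < a) (hab : a ≤ b)
    (hb : b < 1) :
    ∫ r in a..b, (-Real.log r) ^ (-β) / r =
      ((-Real.log a) ^ (1 - β) - (-Real.log b) ^ (1 - β)) / (1 - β) := by
  rw [intervalIntegral.integral_eq_sub_of_hasDerivAt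
    (f := fun r => -(-Real.log r) ^ (1 - β) / (1 - β))]
  · ring
  · intro r hr
    rw [Set.uIcc_of_le hab] at hr
    exact hasDerivAt_neg_log_rpow hβ₁ (ha.trans_le hr.1) (hr.2.trans_lt hb)
  · apply ContinuousOn.intervalIntegrable
    rw [Set.uIcc_of_le hab]
    exact continuousOn_neg_log_rpow_div ha hb

theorem lintegral_neg_log_rpow_div {β : ℝ} (hβ₁ : β < 1) {a b : ℝ} (ha : 0 < a) (hab : a ≤ b)
    (hb : b < 1) :
    ∫⁻ r in Set.Ioo a b, ENNReal.ofReal ((-Real.log r) ^ (-β) / r) =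
      ENNReal.ofReal (((-Real.log a) ^ (1 - β) - (-Real.log b) ^ (1 - β)) / (1 - β)) := by
  rw [← integral_neg_log_rpow_div hβ₁ ha hab hb, intervalIntegral.integral_of_le hab,
    integral_Ioc_eq_integral_Ioo, ofReal_integral_eq_lintegral_ofReal]
  · exact ((continuousOn_neg_log_rpow_div ha hb).integrableOn_Icc).mono_set Set.Ioo_subset_Icc_self
  · filter_upwards [ae_restrict_mem measurableSet_Ioo] with r hr
    have h0 : 0 < r := ha.trans hr.1
    have hl : 0 < -Real.log r := by linarith [Real.log_neg h0 (hr.2.trans hb)]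
    positivity

/-- The energy density along a ray. -/
noncomputable def rayEnergy (n : ℕ) (β : ℝ) (φ : Eu n → ℝ) (θ : Eu n) (s : Set ℝ) : ℝ≥0∞ :=
  ∫⁻ r in s, ENNReal.ofReal (r ^ n * (-Real.log r) ^ (β * n)) * ‖gradient φ (r • θ)‖ₑ ^ (n + 1)

theorem continuous_gradient {n : ℕ} {φ : Eu n → ℝ} (hφ : ContDiff ℝ 1 φ) :
    Continuous (gradient φ) := by
  unfold gradient
  exact (LinearIsometryEquiv.continuous _).comp (hφ.continuous_fderiv one_ne_zero)

theorem norm_gradient {n : ℕ} (φ : Eu n → ℝ) (x : Eu n) : ‖gradient φ x‖ = ‖fderiv ℝ φ x‖ := by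
  simp [gradient]

theorem enorm_sub_le_lintegral_gradient {n : ℕ} {φ : Eu n → ℝ} (hφ : ContDiff ℝ 1 φ)
    {θ : Eu n} (hθ : ‖θ‖ = 1) {a b : ℝ} (hab : a ≤ b) :
    ‖φ (a • θ) - φ (b • θ)‖ₑ ≤ ∫⁻ r in Set.Ioo a b, ‖gradient φ (r • θ)‖ₑ := by
  have hd : ∀ r : ℝ, HasDerivAt (fun r : ℝ => φ (r • θ)) (fderiv ℝ φ (r • θ) θ) r := by
    intro r
    have h1 : HasDerivAt (fun r : ℝ => r • θ) θ r := by
      simpa using (hasDerivAt_id r).smul_const θ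
    exact ((hφ.differentiable one_ne_zero _).hasFDerivAt).comp_hasDerivAt r h1
  have hc : Continuous fun r : ℝ => fderiv ℝ φ (r • θ) θ :=
    ((hφ.continuous_fderiv one_ne_zero).comp (continuous_id.smul continuous_const)).clm_apply
      continuous_const
  have hint := intervalIntegral.integral_eq_sub_of_hasDerivAt (a := a) (b := b)
    (fun r _ => hd r) (hc.intervalIntegrable _ _)
  rw [← enorm_neg, neg_sub, ← hint, intervalIntegral.integral_of_le hab,
    integral_Ioc_eq_integral_Ioo]
  refine (enorm_integral_le_lintegral_enorm _).trans (lintegral_mono fun r => ?_)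
  rw [enorm_le_iff_norm_le, norm_gradient]
  exact ((fderiv ℝ φ (r • θ)).le_opNorm θ).trans (by rw [hθ, mul_one])

theorem enorm_sub_pow_le_rayEnergy {n : ℕ} (hn : 1 ≤ n) {β : ℝ} (hβ₁ : β < 1) {φ : Eu n → ℝ}
    (hφ : ContDiff ℝ 1 φ) {θ : Eu n} (hθ : ‖θ‖ = 1) {a b : ℝ} (ha : 0 < a) (hab : a ≤ b)
    (hb : b < 1) :
    ENNReal.ofReal (|φ (a • θ) - φ (b • θ)| ^ (n + 1)) ≤
      ENNReal.ofReal
        ((((-Real.log a) ^ (1 - β) - (-Real.log b) ^ (1 - β)) / (1 - β)) ^ n) *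
      rayEnergy n β φ θ (Set.Ioo a b) := by
  have hn' : (1 : ℝ) ≤ n := by exact_mod_cast hn
  set W : ℝ → ℝ := fun r => r * (-Real.log r) ^ β with hW
  have hWpos : ∀ r ∈ Set.Ioo a b, 0 < W r := by
    intro r hr
    have h0 : 0 < r := ha.trans hr.1
    have hl : 0 < -Real.log r := by linarith [Real.log_neg h0 (hr.2.trans hb)]
    positivity
  set f : ℝ → ℝ≥0∞ := fun r =>
    ENNReal.ofReal (W r ^ ((n : ℝ) / (n + 1))) * ‖gradient φ (r • θ)‖ₑ
  set g : ℝ → ℝ≥0∞ := fun r => ENNReal.ofReal (W r ^ (-((n : ℝ) / (n + 1))))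
  have hWm : Measurable W := by fun_prop
  have hgm : Measurable fun r : ℝ => ‖gradient φ (r • θ)‖ₑ :=
    ((continuous_gradient hφ).comp (continuous_id.smul continuous_const)).enorm.measurable
  have hp : ((n : ℝ) + 1).HolderConjugate (((n : ℝ) + 1) / n) := by
    rw [Real.holderConjugate_iff]
    constructor
    · linarith
    · field_simp
      ring
  have hH := ENNReal.lintegral_mul_le_Lp_mul_Lq (volume.restrict (Set.Ioo a b)) hp
    (f := f) (g := g) (by fun_prop) (by fun_prop)
  have e1 : ∫⁻ r in Set.Ioo a b, (f * g) r = ∫⁻ r in Set.Ioo a b, ‖gradient φ (r • θ)‖ₑ := by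
    refine setLIntegral_congr_fun measurableSet_Ioo fun r hr => ?_
    have := hWpos r hr
    simp only [f, g, Pi.mul_apply]
    rw [mul_right_comm, ← ENNReal.ofReal_mul (by positivity), ← Real.rpow_add this]
    simp
  have e2 : ∫⁻ r in Set.Ioo a b, f r ^ ((n : ℝ) + 1) = rayEnergy n β φ θ (Set.Ioo a b) := by
    refine setLIntegral_congr_fun measurableSet_Ioo fun r hr => ?_
    have := hWpos r hr
    have h0 : 0 < r := ha.trans hr.1
    have hl : 0 < -Real.log r := by linarith [Real.log_neg h0 (hr.2.trans hb)]
    simp only [f]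
    rw [ENNReal.mul_rpow_of_nonneg _ _ (by positivity),
      ENNReal.ofReal_rpow_of_nonneg (by positivity) (by positivity), ← Real.rpow_mul this.le,
      div_mul_cancel₀ _ (by positivity)]
    congr 1
    · rw [Real.rpow_natCast, hW, mul_pow, Real.rpow_mul_natCast hl.le]
    · exact_mod_cast ENNReal.rpow_natCast _ (n + 1)
  have e3 : ∫⁻ r in Set.Ioo a b, g r ^ (((n : ℝ) + 1) / n) =
      ENNReal.ofReal (((-Real.log a) ^ (1 - β) - (-Real.log b) ^ (1 - β)) / (1 - β)) := by
    rw [← lintegral_neg_log_rpow_div hβ₁ ha hab hb]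
    refine setLIntegral_congr_fun measurableSet_Ioo fun r hr => ?_
    have := hWpos r hr
    have h0 : 0 < r := ha.trans hr.1
    have hl : 0 < -Real.log r := by linarith [Real.log_neg h0 (hr.2.trans hb)]
    simp only [g]
    rw [ENNReal.ofReal_rpow_of_nonneg (by positivity) (by positivity), ← Real.rpow_mul this.le]
    congr 1
    rw [show -((n : ℝ) / (n + 1)) * ((n + 1) / n) = -1 by field_simp, Real.rpow_neg_one, hW,
      Real.rpow_neg hl.le, mul_inv]
    field_simp
  rw [e1, e2, e3] at hH
  have hs : 0 ≤ ((-Real.log a) ^ (1 - β) - (-Real.log b) ^ (1 - β)) / (1 - β) := by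
    apply div_nonneg _ (by linarith)
    have hlb : 0 ≤ -Real.log b := by linarith [Real.log_nonpos (ha.le.trans hab) hb.le]
    have : -Real.log b ≤ -Real.log a := by linarith [Real.log_le_log ha hab]
    have := Real.rpow_le_rpow hlb this (show 0 ≤ 1 - β by linarith)
    linarith
  have hfin := pow_le_pow_left₀ zero_le ((enorm_sub_le_lintegral_gradient hφ hθ hab).trans hH)
    (n + 1)
  rw [mul_pow, ← ENNReal.rpow_natCast, ← ENNReal.rpow_natCast, ← ENNReal.rpow_natCast,
    ← ENNReal.rpow_mul, ← ENNReal.rpow_mul] at hfin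
  push_cast at hfin
  rw [one_div, inv_mul_cancel₀ (by positivity), ENNReal.rpow_one, one_div, inv_div,
    div_mul_cancel₀ _ (by positivity), ENNReal.rpow_natCast, mul_comm] at hfin
  rw [ENNReal.ofReal_pow hs]
  refine le_trans (le_of_eq ?_) hfin
  rw [ENNReal.ofReal_pow (abs_nonneg _), ← Real.norm_eq_abs, ofReal_norm]
  exact_mod_cast (ENNReal.rpow_natCast _ (n + 1)).symm

/-- The pointwise increment bound for a `C¹_c` function along a ray. -/
theorem increments_le_rayEnergy {n : ℕ} (hn : 1 ≤ n) {β : ℝ} (hβ₁ : β < 1) {φ : Eu n → ℝ}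
    (hφ : IsC1c (n + 1) φ) {θ : Eu n} (hθ : ‖θ‖ = 1) {a b : ℝ} (ha : 0 < a) (hab : a ≤ b)
    (hb : b < 1) :
    ENNReal.ofReal (|φ (b • θ)| ^ (n + 1) / ((-Real.log b) ^ (1 - β)) ^ n +
        |φ (a • θ) - φ (b • θ)| ^ (n + 1) /
          ((-Real.log a) ^ (1 - β) - (-Real.log b) ^ (1 - β)) ^ n) ≤
      ENNReal.ofReal (((1 - β)⁻¹) ^ n) * rayEnergy n β φ θ (Set.Ioo 0 1) := by
  obtain ⟨hφ1, hφc, hφs⟩ := hφ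
  have hb0 : 0 < b := ha.trans_le hab
  have hβ' : 0 < 1 - β := by linarith
  have hlb : 0 < -Real.log b := by linarith [Real.log_neg hb0 hb]
  obtain ⟨c, hbc, hc1, hφ0⟩ : ∃ c, b < c ∧ c < 1 ∧ φ (c • θ) = 0 := by
    obtain ⟨ρ, hρ, hρs⟩ : ∃ ρ < 1, tsupport φ ⊆ Metric.closedBall (0 : Eu n) ρ := by
      rcases (tsupport φ).eq_empty_or_nonempty with he | hne
      · exact ⟨0, one_pos, by simp [he]⟩
      · obtain ⟨x, hx, hmax⟩ := hφc.isCompact.exists_isMaxOn hne continuous_norm.continuousOn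
        refine ⟨‖x‖, by simpa [unitBall] using hφs hx, fun y hy => ?_⟩
        simpa using hmax hy
    refine ⟨(max b ρ + 1) / 2, ?_, ?_, ?_⟩
    · linarith [le_max_left b ρ, max_lt hb hρ]
    · linarith [max_lt hb hρ]
    · apply image_eq_zero_of_notMem_tsupport
      intro hmem
      have hm := hρs hmem
      have hpos : 0 < (max b ρ + 1) / 2 := by linarith [le_max_left b ρ]
      rw [mem_closedBall_zero_iff, norm_smul, hθ, mul_one, Real.norm_eq_abs,
        abs_of_pos hpos] at hm
      linarith [le_max_right b ρ, max_lt hb hρ]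
  have hlc : 0 < -Real.log c := by linarith [Real.log_neg (hb0.trans hbc) hc1]
  have h1 := enorm_sub_pow_le_rayEnergy hn hβ₁ hφ1 hθ ha hab hb
  have h2 := enorm_sub_pow_le_rayEnergy hn hβ₁ hφ1 hθ hb0 hbc.le hc1
  rw [hφ0, sub_zero] at h2
  have key1 : ENNReal.ofReal (|φ (b • θ)| ^ (n + 1) / ((-Real.log b) ^ (1 - β)) ^ n) ≤
      ENNReal.ofReal (((1 - β)⁻¹) ^ n) * rayEnergy n β φ θ (Set.Ioo b c) := by
    rw [ENNReal.ofReal_div_of_pos (by positivity)]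
    apply ENNReal.div_le_of_le_mul
    refine h2.trans ?_
    rw [mul_right_comm, ← ENNReal.ofReal_mul (by positivity), ← mul_pow]
    gcongr
    · apply div_nonneg _ hβ'.le
      rw [sub_nonneg]
      apply Real.rpow_le_rpow hlc.le _ hβ'.le
      linarith [Real.log_le_log hb0 hbc.le]
    · rw [div_eq_inv_mul]
      gcongr
      have : 0 < (-Real.log c) ^ (1 - β) := by positivity
      linarith
  have key2 : ENNReal.ofReal (|φ (a • θ) - φ (b • θ)| ^ (n + 1) /
        ((-Real.log a) ^ (1 - β) - (-Real.log b) ^ (1 - β)) ^ n) ≤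
      ENNReal.ofReal (((1 - β)⁻¹) ^ n) * rayEnergy n β φ θ (Set.Ioo a b) := by
    rcases hab.eq_or_lt with rfl | hlt
    · simp
    have hpos : 0 < (-Real.log a) ^ (1 - β) - (-Real.log b) ^ (1 - β) := by
      rw [sub_pos]
      apply Real.rpow_lt_rpow hlb.le _ hβ'
      linarith [Real.log_lt_log ha hlt]
    rw [ENNReal.ofReal_div_of_pos (by positivity)]
    apply ENNReal.div_le_of_le_mul
    refine h1.trans (le_of_eq ?_)
    rw [mul_right_comm, ← ENNReal.ofReal_mul (by positivity), ← mul_pow, div_eq_inv_mul]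
  refine ENNReal.ofReal_add_le.trans ((add_le_add key1 key2).trans ?_)
  rw [← mul_add]
  gcongr
  unfold rayEnergy
  rw [← lintegral_union measurableSet_Ioo]
  · apply lintegral_mono_set
    apply Set.union_subset <;> intro r hr
    · exact ⟨hb0.trans hr.1, hr.2.trans hc1⟩
    · exact ⟨ha.trans hr.1, hr.2.trans hb⟩
  · rw [Set.disjoint_left]
    intro r hr hr'
    linarith [hr.1, hr'.2]

theorem lintegral_rayEnergy {n : ℕ} {β : ℝ} {φ : Eu n → ℝ} (hφ : ContDiff ℝ 1 φ) :
    ∫⁻ θ, rayEnergy n β φ θ.1 (Set.Ioo 0 1) ∂(sphereMeasure n) =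
      weightedNorm (n + 1) β (gradient φ) ^ (n + 1) := by
  rw [weightedNorm_pow_eq, lintegral_weightedMeasure_polar]
  · rfl
  · exact ((continuous_gradient hφ).enorm.measurable).pow_const _

theorem ae_restrict_of_ae_weightedMeasure {n : ℕ} {β : ℝ} {P : Eu n → Prop}
    (h : ∀ᵐ x ∂(weightedMeasure (n + 1) β), P x) :
    ∀ᵐ x ∂(volume.restrict (unitBall (n + 1))), P x := by
  rw [weightedMeasure, ae_withDensity_iff measurable_weight1.ennreal_ofReal] at h
  have h0 : ∀ᵐ x ∂(volume.restrict (unitBall (n + 1))), x ≠ 0 :=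
    ae_restrict_of_ae (Measure.ae_ne volume 0)
  filter_upwards [h, h0, ae_restrict_mem Metric.isOpen_ball.measurableSet] with x hx hx0 hxb
  apply hx
  have hx1 : ‖x‖ < 1 := by simpa [unitBall] using hxb
  rw [weight1_eq hx1]
  have : 0 < -Real.log ‖x‖ := by linarith [Real.log_neg (norm_pos_iff.2 hx0) hx1]
  simp only [ne_eq, ENNReal.ofReal_eq_zero, not_le]
  positivity

theorem aestronglyMeasurable_weightedMeasure {n : ℕ} {β : ℝ} {F : Type*} [NormedAddCommGroup F]
    {f : Eu n → F} (hf : LocallyIntegrableOn f (unitBall (n + 1))) :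
    AEStronglyMeasurable f (weightedMeasure (n + 1) β) :=
  hf.aestronglyMeasurable.mono_ac (withDensity_absolutelyContinuous _ _)

theorem exists_subseq_tendsto_ae {n : ℕ} {β : ℝ} {u : Eu n → ℝ} {φ : ℕ → Eu n → ℝ}
    (hu : LocallyIntegrableOn u (unitBall (n + 1))) (hφ : ∀ i, IsC1c (n + 1) (φ i))
    (h : Tendsto (fun i => weightedNorm (n + 1) β fun x => φ i x - u x) atTop (𝓝 0)) :
    ∃ ns : ℕ → ℕ, StrictMono ns ∧ ∀ᵐ x ∂(volume.restrict (unitBall (n + 1))),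
      Tendsto (fun i => φ (ns i) x) atTop (𝓝 (u x)) := by
  have hm : TendstoInMeasure (weightedMeasure (n + 1) β) φ atTop u := by
    refine tendstoInMeasure_of_tendsto_eLpNorm (p := ((n + 1 : ℕ) : ℝ≥0∞)) (by simp)
      (fun i => (hφ i).1.continuous.aestronglyMeasurable)
      (aestronglyMeasurable_weightedMeasure hu) h
  obtain ⟨ns, hns, hae⟩ := hm.exists_seq_tendsto_ae
  exact ⟨ns, hns, ae_restrict_of_ae_weightedMeasure hae⟩

/-- A radial admissible function satisfies, at almost all radii, the sharp increment bounds. -/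
theorem increments_le_of_mem_admissible {n : ℕ} (hn : 1 ≤ n) {β : ℝ} (hβ₁ : β < 1)
    {u : Eu n → ℝ} (hu : u ∈ admissible (n + 1) β) :
    ∃ (f : ℝ → ℝ) (R : Set ℝ),
      (∀ᵐ x ∂(volume.restrict (unitBall (n + 1))), u x = f ‖x‖ ∧ ‖x‖ ∈ R) ∧
      ∀ a ∈ R, ∀ b ∈ R, 0 < a → a ≤ b → b < 1 →
        surfaceArea (n + 1) * (|f b| ^ (n + 1) / ((-Real.log b) ^ (1 - β)) ^ n +
          |f a - f b| ^ (n + 1) /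
            ((-Real.log a) ^ (1 - β) - (-Real.log b) ^ (1 - β)) ^ n) ≤ ((1 - β)⁻¹) ^ n := by
  obtain ⟨⟨f, hf⟩, g, ⟨⟨hul, hgl, -⟩, φ, hφ, hφu, hφg⟩, hg1⟩ := hu
  obtain ⟨ns, hns, hae⟩ := exists_subseq_tendsto_ae hul hφ hφu
  have hβ' : 0 < 1 - β := by linarith
  have hb : MeasurableSet (unitBall (n + 1)) := Metric.isOpen_ball.measurableSet
  have hP : ∀ᵐ x : Eu n, x ∈ unitBall (n + 1) →
      Tendsto (fun i => φ (ns i) x) atTop (𝓝 (f ‖x‖)) := by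
    rw [← ae_restrict_iff' hb]
    filter_upwards [hae, hf] with x h1 h2
    rwa [← h2]
  have hnorm : ∀ (θ : Metric.sphere (0 : Eu n) 1) (r : ℝ), 0 < r → ‖r • θ.1‖ = r := by
    intro θ r hr
    simp [norm_smul, abs_of_pos hr]
  set R : Set ℝ := {r | 0 < r → r < 1 → ∀ᵐ θ ∂(sphereMeasure n),
    Tendsto (fun i => φ (ns i) (r • θ.1)) atTop (𝓝 (f r))} with hR
  refine ⟨f, R, ?_, ?_⟩
  · have hRae : ∀ᵐ r ∂(volume.restrict (Set.Ioi (0 : ℝ))), r ∈ R := by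
      filter_upwards [ae_ae_sphere_of_ae hP] with r hr h0 h1
      filter_upwards [hr] with θ hθ
      rw [hnorm θ r h0] at hθ
      exact hθ (by simpa [unitBall, hnorm θ r h0] using h1)
    filter_upwards [hf, ae_restrict_of_ae (ae_norm_of_ae hRae)] with x h1 h2
    exact ⟨h1, h2⟩
  · intro a ha b hb' ha0 hab hb1
    have hb0 := ha0.trans_le hab
    set A : ℝ := (-Real.log b) ^ (1 - β)
    set D : ℝ := (-Real.log a) ^ (1 - β) - (-Real.log b) ^ (1 - β)
    have hA : 0 ≤ A := by
      have : 0 < -Real.log b := by linarith [Real.log_neg hb0 hb1]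
      positivity
    have hD : 0 ≤ D := by
      have : 0 < -Real.log b := by linarith [Real.log_neg hb0 hb1]
      have : -Real.log b ≤ -Real.log a := by linarith [Real.log_le_log ha0 hab]
      rw [sub_nonneg]
      gcongr
    set B : ℕ → Metric.sphere (0 : Eu n) 1 → ℝ≥0∞ := fun i θ =>
      ENNReal.ofReal (|φ (ns i) (b • θ.1)| ^ (n + 1) / A ^ n +
        |φ (ns i) (a • θ.1) - φ (ns i) (b • θ.1)| ^ (n + 1) / D ^ n)
    have hBm : ∀ i, Measurable (B i) := by
      intro i
      have hc := (hφ (ns i)).1.continuous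
      refine (ENNReal.continuous_ofReal.comp ?_).measurable
      fun_prop
    have hlim : ∀ᵐ θ ∂(sphereMeasure n), liminf (fun i => B i θ) atTop =
        ENNReal.ofReal (|f b| ^ (n + 1) / A ^ n + |f a - f b| ^ (n + 1) / D ^ n) := by
      filter_upwards [ha ha0 (hab.trans_lt hb1), hb' hb0 hb1] with θ h1 h2
      apply Tendsto.liminf_eq
      apply ENNReal.tendsto_ofReal
      exact ((h2.abs.pow _).div_const _).add (((h1.sub h2).abs.pow _).div_const _)
    have hgm : AEStronglyMeasurable g (weightedMeasure (n + 1) β) :=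
      aestronglyMeasurable_weightedMeasure hgl
    have hN : ∀ i, weightedNorm (n + 1) β (gradient (φ (ns i))) ≤
        weightedNorm (n + 1) β (fun x => gradient (φ (ns i)) x - g x) + 1 := by
      intro i
      have hgrad : AEStronglyMeasurable (gradient (φ (ns i))) (weightedMeasure (n + 1) β) :=
        (continuous_gradient (hφ (ns i)).1).aestronglyMeasurable
      have := eLpNorm_add_le (hgrad.sub hgm) hgm (p := ((n + 1 : ℕ) : ℝ≥0∞))
        (by exact_mod_cast Nat.le_add_left 1 n)
      rw [sub_add_cancel] at this
      exact this.trans (add_le_add le_rfl hg1)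
    have hBint : ∀ i, ∫⁻ θ, B i θ ∂(sphereMeasure n) ≤ ENNReal.ofReal (((1 - β)⁻¹) ^ n) *
        (weightedNorm (n + 1) β (fun x => gradient (φ (ns i)) x - g x) + 1) ^ (n + 1) := by
      intro i
      calc ∫⁻ θ, B i θ ∂(sphereMeasure n) ≤ ∫⁻ θ, ENNReal.ofReal (((1 - β)⁻¹) ^ n) *
            rayEnergy n β (φ (ns i)) θ.1 (Set.Ioo 0 1) ∂(sphereMeasure n) :=
            lintegral_mono fun θ => increments_le_rayEnergy hn hβ₁ (hφ (ns i)) (by simp) ha0 hab hb1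
        _ = ENNReal.ofReal (((1 - β)⁻¹) ^ n) *
              weightedNorm (n + 1) β (gradient (φ (ns i))) ^ (n + 1) := by
            rw [lintegral_const_mul' _ _ ENNReal.ofReal_ne_top, lintegral_rayEnergy (hφ (ns i)).1]
        _ ≤ _ := by gcongr; exact hN i
    have hrhs : Tendsto (fun i => ENNReal.ofReal (((1 - β)⁻¹) ^ n) *
        (weightedNorm (n + 1) β (fun x => gradient (φ (ns i)) x - g x) + 1) ^ (n + 1)) atTop
        (𝓝 (ENNReal.ofReal (((1 - β)⁻¹) ^ n) * (0 + 1) ^ (n + 1))) := by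
      apply ENNReal.Tendsto.const_mul _ (Or.inr ENNReal.ofReal_ne_top)
      apply ENNReal.Tendsto.pow
      exact (hφg.comp hns.tendsto_atTop).add tendsto_const_nhds
    have hfat := lintegral_liminf_le (μ := sphereMeasure n) (u := atTop) hBm
    rw [lintegral_congr_ae hlim, lintegral_const, toSphere_univ_eq] at hfat
    have hfin := hfat.trans ((liminf_le_liminf (Eventually.of_forall hBint)).trans_eq
      hrhs.liminf_eq)
    rw [zero_add, one_pow, mul_one, ← ENNReal.ofReal_mul (by positivity),
      ENNReal.ofReal_le_ofReal_iff (by positivity)] at hfin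
    linarith

theorem lintegral_inv_indicator_neg_log_le (p q : ℝ) :
    ∫⁻ r in Set.Ioi (0 : ℝ), ENNReal.ofReal r⁻¹ *
      (Set.Icc p q).indicator (fun _ => (1 : ℝ≥0∞)) (-Real.log r) ≤ ENNReal.ofReal (q - p) := by
  rcases lt_or_ge q p with hqp | hpq
  · simp [Set.Icc_eq_empty (not_le.2 hqp)]
  have hle : Real.exp (-q) ≤ Real.exp (-p) := by gcongr
  calc ∫⁻ r in Set.Ioi (0 : ℝ), ENNReal.ofReal r⁻¹ *
        (Set.Icc p q).indicator (fun _ => (1 : ℝ≥0∞)) (-Real.log r)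
      = ∫⁻ r in Set.Ioi (0 : ℝ), (Set.Icc (Real.exp (-q)) (Real.exp (-p))).indicator
          (fun r => ENNReal.ofReal r⁻¹) r := by
        refine setLIntegral_congr_fun measurableSet_Ioi fun r hr => ?_
        have hiff : -Real.log r ∈ Set.Icc p q ↔ r ∈ Set.Icc (Real.exp (-q)) (Real.exp (-p)) := by
          rw [Set.mem_Icc, Set.mem_Icc, ← Real.le_log_iff_exp_le hr, ← Real.log_le_iff_le_exp hr]
          constructor <;> rintro ⟨h1, h2⟩ <;> constructor <;> linarith
        by_cases h : -Real.log r ∈ Set.Icc p q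
        · simp only [Set.indicator_of_mem h, Set.indicator_of_mem (hiff.1 h), mul_one]
        · simp only [Set.indicator_of_notMem h, Set.indicator_of_notMem (fun h' => h (hiff.2 h')),
            mul_zero]
    _ ≤ ∫⁻ r, (Set.Icc (Real.exp (-q)) (Real.exp (-p))).indicator
          (fun r => ENNReal.ofReal r⁻¹) r := setLIntegral_le_lintegral _ _
    _ = ∫⁻ r in Set.Icc (Real.exp (-q)) (Real.exp (-p)), ENNReal.ofReal r⁻¹ :=
        lintegral_indicator measurableSet_Icc _
    _ = ENNReal.ofReal (q - p) := by
        have hc : ContinuousOn (fun r : ℝ => r⁻¹) (Set.Icc (Real.exp (-q)) (Real.exp (-p))) :=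
          continuousOn_inv₀.mono fun r hr => ((Real.exp_pos _).trans_le hr.1).ne'
        rw [← ofReal_integral_eq_lintegral_ofReal hc.integrableOn_Icc,
          integral_Icc_eq_integral_Ioc, ← intervalIntegral.integral_of_le hle,
          integral_inv_of_pos (Real.exp_pos _) (Real.exp_pos _), ← Real.exp_sub, Real.log_exp]
        · ring_nf
        · filter_upwards [ae_restrict_mem measurableSet_Icc] with r hr
          exact inv_nonneg.2 ((Real.exp_pos _).le.trans hr.1)

/-- The scale-invariant measure of a spherical shell. -/
theorem lintegral_shell_le (n : ℕ) (p q : ℝ) :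
    ∫⁻ x : Eu n, ENNReal.ofReal ((‖x‖ ^ (n + 1))⁻¹) *
      (Set.Icc p q).indicator (fun _ => (1 : ℝ≥0∞)) (-Real.log ‖x‖) ≤
      ENNReal.ofReal (surfaceArea (n + 1)) * ENNReal.ofReal (q - p) := by
  have hm : Measurable fun r : ℝ => ENNReal.ofReal ((r ^ (n + 1))⁻¹) *
      (Set.Icc p q).indicator (fun _ => (1 : ℝ≥0∞)) (-Real.log r) := by
    apply Measurable.mul (by fun_prop)
    exact (measurable_const.indicator measurableSet_Icc).comp (by fun_prop)
  rw [lintegral_norm_eq hm, toSphere_univ_eq]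
  gcongr
  refine le_trans (le_of_eq ?_) (lintegral_inv_indicator_neg_log_le p q)
  refine setLIntegral_congr_fun measurableSet_Ioi fun r hr => ?_
  have hr' : 0 < r := hr
  rw [← mul_assoc, ← ENNReal.ofReal_mul (by positivity)]
  congr 2
  rw [pow_succ]
  field_simp

theorem X1_rpow_neg {β r : ℝ} (h0 : 0 < r) (h1 : r < 1) :
    X1 r ^ (-β) = (1 + -Real.log r) ^ β := by
  have hl : 0 < -Real.log r := by linarith [Real.log_neg h0 h1]
  rw [X1, Real.log_div (Real.exp_pos _).ne' h0.ne', Real.log_exp, ← sub_eq_add_neg,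
    Real.inv_rpow (by linarith), Real.rpow_neg (by linarith), inv_inv]

theorem Y1_rpow_neg {β r : ℝ} (h0 : 0 < r) (h1 : r < 1) :
    Y1 r ^ (-β) = (-Real.log r) ^ β := by
  have hl : 0 < -Real.log r := by linarith [Real.log_neg h0 h1]
  rw [Y1, log_one_div_eq_neg, Real.inv_rpow hl.le, Real.rpow_neg hl.le, inv_inv]

theorem criticalExponent_succ (n : ℕ) (β : ℝ) :
    criticalExponent (n + 1) β = (n + 1) * (surfaceArea (n + 1) ^ (1 / (n : ℝ)) * (1 - β)) := by
  rw [criticalExponent]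
  push_cast
  rw [add_sub_cancel_right]
  ring

/-- Passing from the weight `t ^ β` to `(1 + t) ^ β` costs a bounded amount in the exponent. -/
theorem mul_one_add_rpow_le {β t Y : ℝ} (hβ₀ : 0 ≤ β) (hβ₁ : β ≤ 1) (ht : 0 < t) (hY : 0 ≤ Y)
    (h : t ^ β * Y ≤ t) : Y * (1 + t) ^ β ≤ β + t ^ β * Y := by
  have hb : (1 + 1 / t) ^ β ≤ 1 + β * (1 / t) :=
    rpow_one_add_le_one_add_mul_self (by have : 0 < 1 / t := by positivity
                                         linarith) hβ₀ hβ₁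
  have he : (1 + t) ^ β = t ^ β * (1 + 1 / t) ^ β := by
    rw [← Real.mul_rpow ht.le (by positivity)]
    congr 1
    field_simp
    ring
  have hx : 0 ≤ t ^ β * Y := by positivity
  calc Y * (1 + t) ^ β = (t ^ β * Y) * (1 + 1 / t) ^ β := by rw [he]; ring
    _ ≤ (t ^ β * Y) * (1 + β * (1 / t)) := by gcongr
    _ = t ^ β * Y + β * ((t ^ β * Y) / t) := by ring
    _ ≤ t ^ β * Y + β * 1 := by
      gcongr
      exact (div_le_one ht).2 h
    _ = _ := by ring

theorem moser_constant_rpow {n : ℕ} (hn : 1 ≤ n) {σ β : ℝ} (hσ : 0 < σ) (hβ₁ : β < 1) :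
    ((σ * (1 - β) ^ n) ^ (((n : ℝ) + 1)⁻¹)) ^ (((n : ℝ) + 1) / n) =
      σ ^ (1 / (n : ℝ)) * (1 - β) := by
  have hn' : (1 : ℝ) ≤ n := by exact_mod_cast hn
  have hβ' : 0 < 1 - β := by linarith
  rw [← Real.rpow_mul (by positivity), Real.mul_rpow hσ.le (by positivity),
    show ((n : ℝ) + 1)⁻¹ * ((n + 1) / n) = 1 / n by field_simp, ← Real.rpow_natCast (1 - β) n,
    ← Real.rpow_mul hβ'.le, mul_one_div_cancel (by positivity), Real.rpow_one]

/-- The uniform bound at the critical exponent. -/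
theorem exists_lintegral_exp_le {n : ℕ} (hn : 1 ≤ n) {β : ℝ} (hβ₀ : 0 < β) (hβ₁ : β < 1) {α : ℝ}
    (hα : α ≤ criticalExponent (n + 1) β) :
    ∃ K : ℝ≥0∞, K < ⊤ ∧ ∀ u ∈ admissible (n + 1) β,
      ∫⁻ x in unitBall (n + 1), ENNReal.ofReal
        (Real.exp (α * |u x| ^ (((n : ℝ) + 1) / n) * X1 ‖x‖ ^ (-β))) ≤ K := by
  obtain ⟨C, hC, hsub⟩ := exists_moser_sublevel_subset hn hβ₀ hβ₁
  have hσ := surfaceArea_pos n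
  have hβ' : 0 < 1 - β := by linarith
  set σ := surfaceArea (n + 1)
  set A : ℝ := Real.exp ((n + 1) * β) with hA
  have hApos : 0 < A := Real.exp_pos _
  have hterm : ∀ k : ℕ, 0 ≤ A * Real.exp (-k) * (σ * (3 * (C * (k + 1)))) := by
    intro k; positivity
  have hsum : Summable fun k : ℕ => A * Real.exp (-k) * (σ * (3 * (C * (k + 1)))) := by
    have h1 := Real.summable_pow_mul_exp_neg_nat_mul 1 one_pos
    have h0 := Real.summable_pow_mul_exp_neg_nat_mul 0 one_pos
    refine ((h1.add h0).mul_left (A * σ * 3 * C)).congr fun k => ?_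
    rw [show -(1 : ℝ) * k = -k by ring]
    ring
  refine ⟨∑' k : ℕ, ENNReal.ofReal (A * Real.exp (-k) * (σ * (3 * (C * (k + 1))))), ?_, ?_⟩
  · rw [← ENNReal.ofReal_tsum_of_nonneg hterm hsum]
    exact ENNReal.ofReal_lt_top
  intro u hu
  obtain ⟨f, R, hfR, hpair⟩ := increments_le_of_mem_admissible hn hβ₁ hu
  set c : ℝ := (σ * (1 - β) ^ n) ^ (((n : ℝ) + 1)⁻¹) with hc
  have hc0 : 0 < c := by positivity
  have hcpow : c ^ (n + 1) = σ * (1 - β) ^ n := by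
    have := Real.rpow_inv_natCast_pow (x := σ * (1 - β) ^ n) (by positivity)
      (Nat.succ_ne_zero n)
    push_cast at this
    exact this
  set y : ℝ → ℝ := fun t => c * |f (Real.exp (-t))| with hy
  set S : Set ℝ := {t | 0 < t ∧ Real.exp (-t) ∈ R} with hS
  have hSpair : ∀ t ∈ S, ∀ r ∈ S, t ≤ r → y t ^ (n + 1) / (t ^ (1 - β)) ^ n
        + |y r - y t| ^ (n + 1) / (r ^ (1 - β) - t ^ (1 - β)) ^ n ≤ 1 := by
    intro t ht r hr htr
    have h := hpair _ hr.2 _ ht.2 (Real.exp_pos _) (by gcongr) (by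
      rw [Real.exp_lt_one_iff]; linarith [ht.1])
    rw [Real.log_exp, Real.log_exp, neg_neg, neg_neg] at h
    have hD : 0 ≤ r ^ (1 - β) - t ^ (1 - β) := by
      have := ht.1
      rw [sub_nonneg]
      gcongr
    have ht0 := ht.1
    have hdiff : |y r - y t| ≤ c * |f (Real.exp (-r)) - f (Real.exp (-t))| := by
      simp only [hy]
      rw [← mul_sub, abs_mul, abs_of_pos hc0]
      exact mul_le_mul_of_nonneg_left
        (abs_abs_sub_abs_le (f (Real.exp (-r))) (f (Real.exp (-t)))) hc0.le
    calc _ ≤ (c * |f (Real.exp (-t))|) ^ (n + 1) / (t ^ (1 - β)) ^ n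
        + (c * |f (Real.exp (-r)) - f (Real.exp (-t))|) ^ (n + 1) /
          (r ^ (1 - β) - t ^ (1 - β)) ^ n := by gcongr
      _ = (1 - β) ^ n * (σ * (|f (Real.exp (-t))| ^ (n + 1) / (t ^ (1 - β)) ^ n
        + |f (Real.exp (-r)) - f (Real.exp (-t))| ^ (n + 1) /
          (r ^ (1 - β) - t ^ (1 - β)) ^ n)) := by
          rw [mul_pow, mul_pow, hcpow]; ring
      _ ≤ (1 - β) ^ n * ((1 - β)⁻¹) ^ n := by gcongr
      _ = 1 := by rw [← mul_pow, mul_inv_cancel₀ hβ'.ne', one_pow]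
  have hy0 : ∀ t, 0 ≤ y t := fun t => by positivity
  choose τ hτ using fun k : ℕ => hsub S y (fun t ht => ht.1) hy0 hSpair (k + 1) (by positivity)
  set G : ℕ → ℝ → ℝ → Eu n → ℝ≥0∞ := fun k p q x =>
    ENNReal.ofReal (A * Real.exp (-k)) * (ENNReal.ofReal ((‖x‖ ^ (n + 1))⁻¹) *
      (Set.Icc p q).indicator (fun _ => (1 : ℝ≥0∞)) (-Real.log ‖x‖)) with hG
  have hGm : ∀ k p q, Measurable (G k p q) := by
    intro k p q
    refine Measurable.const_mul (Measurable.mul (by fun_prop) ?_) _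
    exact (measurable_const.indicator measurableSet_Icc).comp (by fun_prop)
  have hGint : ∀ (k : ℕ) (p q : ℝ), ∫⁻ x, G k p q x ≤
      ENNReal.ofReal (A * Real.exp (-k)) * (ENNReal.ofReal σ * ENNReal.ofReal (q - p)) := by
    intro k p q
    rw [lintegral_const_mul' _ _ ENNReal.ofReal_ne_top]
    gcongr
    exact lintegral_shell_le n p q
  have hbound : ∀ᵐ x ∂(volume.restrict (unitBall (n + 1))),
      ENNReal.ofReal (Real.exp (α * |u x| ^ (((n : ℝ) + 1) / n) * X1 ‖x‖ ^ (-β))) ≤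
        ∑' k : ℕ, (G k 0 (C * (k + 1)) x + G k (τ k - C * (k + 1)) (τ k + C * (k + 1)) x) := by
    have h0 : ∀ᵐ x ∂(volume.restrict (unitBall (n + 1))), x ≠ 0 :=
      ae_restrict_of_ae (Measure.ae_ne volume 0)
    filter_upwards [hfR, h0, ae_restrict_mem Metric.isOpen_ball.measurableSet] with x hx hx0 hxb
    have hx1 : ‖x‖ < 1 := by simpa [unitBall] using hxb
    have hxpos : 0 < ‖x‖ := norm_pos_iff.2 hx0
    set t := -Real.log ‖x‖ with ht
    have htpos : 0 < t := by linarith [Real.log_neg hxpos hx1]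
    have hexp : Real.exp (-t) = ‖x‖ := by rw [ht, neg_neg, Real.exp_log hxpos]
    have htS : t ∈ S := ⟨htpos, by rw [hexp]; exact hx.2⟩
    set Y : ℝ := y t ^ (((n : ℝ) + 1) / n) with hYdef
    have hY0 : 0 ≤ Y := by have := hy0 t; positivity
    have hYle : t ^ β * Y ≤ t := by
      refine moser_deficit_nonneg hn htpos (hy0 t) ?_
      have := hSpair t htS t htS le_rfl
      refine le_trans ?_ this
      simp
    have hexpo : α * |u x| ^ (((n : ℝ) + 1) / n) * X1 ‖x‖ ^ (-β) ≤
        (n + 1) * (β + t ^ β * Y) := by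
      have h1 : criticalExponent (n + 1) β * |u x| ^ (((n : ℝ) + 1) / n) = (n + 1) * Y := by
        simp only [hYdef, hy]
        rw [criticalExponent_succ, hexp, ← hx.1, Real.mul_rpow hc0.le (abs_nonneg _),
          moser_constant_rpow hn hσ hβ₁]
        ring
      rw [X1_rpow_neg hxpos hx1]
      calc α * |u x| ^ (((n : ℝ) + 1) / n) * (1 + t) ^ β ≤
          criticalExponent (n + 1) β * |u x| ^ (((n : ℝ) + 1) / n) * (1 + t) ^ β := by gcongr
        _ = (n + 1) * (Y * (1 + t) ^ β) := by rw [h1]; ring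
        _ ≤ _ := by
          gcongr
          exact mul_one_add_rpow_le hβ₀.le hβ₁.le htpos hY0 hYle
    set H : ℝ := t - t ^ β * Y with hH
    have hH0 : 0 ≤ H := by linarith
    set k := ⌊H⌋₊ with hk
    have hk1 : (k : ℝ) ≤ H := Nat.floor_le hH0
    have hk2 : H < k + 1 := Nat.lt_floor_add_one H
    have hmem := hτ k ⟨htS, hk2.le⟩
    have hmain : ENNReal.ofReal
        (Real.exp (α * |u x| ^ (((n : ℝ) + 1) / n) * X1 ‖x‖ ^ (-β))) ≤
        ENNReal.ofReal (A * Real.exp (-k)) * ENNReal.ofReal ((‖x‖ ^ (n + 1))⁻¹) := by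
      rw [← ENNReal.ofReal_mul (by positivity)]
      refine ENNReal.ofReal_le_ofReal ((Real.exp_le_exp.2 hexpo).trans ?_)
      rw [← hexp, ← Real.exp_nat_mul, ← Real.exp_neg, hA, ← Real.exp_add, ← Real.exp_add]
      apply Real.exp_le_exp.2
      push_cast
      have : (k : ℝ) ≤ (n + 1) * H := by nlinarith
      rw [hH] at this
      linarith
    refine le_trans ?_ (ENNReal.le_tsum k)
    rcases hmem with hmem | hmem
    · refine le_trans ?_ le_self_add
      simp only [hG, Set.indicator_of_mem hmem, mul_one, ← ht]
      exact hmain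
    · refine le_trans ?_ le_add_self
      simp only [hG, Set.indicator_of_mem hmem, mul_one, ← ht]
      exact hmain
  calc ∫⁻ x in unitBall (n + 1), ENNReal.ofReal
        (Real.exp (α * |u x| ^ (((n : ℝ) + 1) / n) * X1 ‖x‖ ^ (-β)))
      ≤ ∫⁻ x in unitBall (n + 1),
        ∑' k : ℕ, (G k 0 (C * (k + 1)) x + G k (τ k - C * (k + 1)) (τ k + C * (k + 1)) x) :=
        lintegral_mono_ae hbound
    _ ≤ ∫⁻ x, ∑' k : ℕ,
        (G k 0 (C * (k + 1)) x + G k (τ k - C * (k + 1)) (τ k + C * (k + 1)) x) :=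
        setLIntegral_le_lintegral _ _
    _ = ∑' k : ℕ, ((∫⁻ x, G k 0 (C * (k + 1)) x) +
          ∫⁻ x, G k (τ k - C * (k + 1)) (τ k + C * (k + 1)) x) := by
        have hGadd : ∀ k : ℕ, Measurable fun x =>
            G k 0 (C * (k + 1)) x + G k (τ k - C * (k + 1)) (τ k + C * (k + 1)) x :=
          fun k => (hGm k _ _).add (hGm k _ _)
        rw [lintegral_tsum fun k => (hGadd k).aemeasurable]
        exact tsum_congr fun k => lintegral_add_left (hGm k _ _) _
    _ ≤ _ := by
        refine ENNReal.tsum_le_tsum fun k => (add_le_add (hGint k _ _) (hGint k _ _)).trans ?_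
        rw [← mul_add, ← mul_add, ← ENNReal.ofReal_add (by simp; positivity)
          (by have : 0 ≤ C * ((k : ℝ) + 1) := by positivity
              linarith),
          ← ENNReal.ofReal_mul hσ.le, ← ENNReal.ofReal_mul (by positivity)]
        apply le_of_eq
        congr 1
        ring

theorem moserSup_X1_lt_top {n : ℕ} (hn : 1 ≤ n) {β : ℝ} (hβ₀ : 0 < β) (hβ₁ : β < 1) {α : ℝ}
    (hα : α ≤ criticalExponent (n + 1) β) : moserSup (n + 1) β α X1 < ⊤ := by
  obtain ⟨K, hK, h⟩ := exists_lintegral_exp_le hn hβ₀ hβ₁ hα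
  have hv : volume (unitBall (n + 1)) ≠ 0 := (Metric.measure_ball_pos volume _ one_pos).ne'
  refine lt_of_le_of_lt (iSup₂_le fun u hu => ?_) (ENNReal.div_lt_top hK.ne hv)
  rw [setLAverage_eq]
  gcongr
  push_cast
  rw [add_sub_cancel_right]
  exact h u hu

/-- A `C¹_c` function belongs to the weighted Sobolev space, with its classical gradient. -/
theorem memW0_of_isC1c {n : ℕ} {β : ℝ} {φ : Eu n → ℝ} (hφ : IsC1c (n + 1) φ) :
    MemW0 (n + 1) β φ (gradient φ) := by
  have hc := hφ.1.continuous
  have hg := continuous_gradient hφ.1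
  refine ⟨⟨hc.locallyIntegrable.locallyIntegrableOn _, hg.locallyIntegrable.locallyIntegrableOn _,
    ?_⟩, fun _ => φ, fun _ => hφ, ?_, ?_⟩
  · intro ψ hψ hψc hψs v
    have hψ0 : ∀ x ∉ unitBall (n + 1), ψ x = 0 := fun x hx =>
      image_eq_zero_of_notMem_tsupport fun h => hx (hψs h)
    have hφ0 : ∀ x ∉ unitBall (n + 1), φ x = 0 := fun x hx =>
      image_eq_zero_of_notMem_tsupport fun h => hx (hφ.2.2 h)
    rw [setIntegral_eq_integral_of_forall_compl_eq_zero fun x hx => by rw [hφ0 x hx, zero_mul],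
      setIntegral_eq_integral_of_forall_compl_eq_zero fun x hx => by rw [hψ0 x hx, mul_zero]]
    have hψ1 : ContDiff ℝ 1 ψ := hψ.of_le (by exact_mod_cast le_top)
    have hdφ : Continuous fun x => fderiv ℝ φ x v :=
      (hφ.1.continuous_fderiv one_ne_zero).clm_apply continuous_const
    have hdψ : Continuous fun x => fderiv ℝ ψ x v :=
      (hψ1.continuous_fderiv one_ne_zero).clm_apply continuous_const
    have hinner : ∀ x, inner ℝ (gradient φ x) v = fderiv ℝ φ x v := by
      intro x
      simp [gradient]
    simp only [hinner]
    exact integral_mul_fderiv_eq_neg_fderiv_mul_of_integrable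
      ((hdφ.mul hψ1.continuous).integrable_of_hasCompactSupport hψc.mul_left)
      ((hc.mul hdψ).integrable_of_hasCompactSupport hφ.2.1.mul_right)
      ((hc.mul hψ1.continuous).integrable_of_hasCompactSupport hψc.mul_left)
      (fun x _ => hφ.1.differentiable one_ne_zero x)
      (fun x _ => hψ1.differentiable one_ne_zero x)
  · simp [weightedNorm]
  · simp [weightedNorm]

/-- Radial functions with a `C¹` profile that is constant near the origin. -/
theorem contDiff_comp_norm {n : ℕ} {V η : ℝ → ℝ} (hη : Continuous η)
    (hV : ∀ r, HasDerivAt V (-η r) r) {ρ : ℝ} (hρ : 0 < ρ) (hc : ∀ r < ρ, V r = V 0) :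
    ContDiff ℝ 1 (fun x : Eu n => V ‖x‖) ∧
      ∀ x : Eu n, ‖gradient (fun x : Eu n => V ‖x‖) x‖ ≤ |η ‖x‖| := by
  have hV1 : ContDiff ℝ 1 V := by
    rw [contDiff_one_iff_deriv]
    refine ⟨fun r => (hV r).differentiableAt, ?_⟩
    rw [show deriv V = fun r => -η r from funext fun r => (hV r).deriv]
    exact hη.neg
  have hev : (fun x : Eu n => V ‖x‖) =ᶠ[𝓝 0] fun _ => V 0 := by
    filter_upwards [Metric.ball_mem_nhds (0 : Eu n) hρ] with x hx
    exact hc _ (by simpa using hx)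
  constructor
  · rw [contDiff_iff_contDiffAt]
    intro x
    rcases eq_or_ne x 0 with rfl | hx
    · exact contDiffAt_const.congr_of_eventuallyEq hev
    · exact hV1.contDiffAt.comp x (contDiffAt_norm ℝ hx)
  · intro x
    rw [norm_gradient]
    rcases eq_or_ne x 0 with rfl | hx
    · rw [hev.fderiv_eq]
      simp
    · have hd : DifferentiableAt ℝ (fun x : Eu n => ‖x‖) x :=
        (contDiffAt_norm ℝ hx (n := 1)).differentiableAt one_ne_zero
      have := (hV ‖x‖).comp_hasFDerivAt x hd.hasFDerivAt
      rw [show fderiv ℝ (fun x : Eu n => V ‖x‖) x = _ from this.fderiv, norm_smul, norm_neg,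
        Real.norm_eq_abs]
      refine mul_le_of_le_one_right (abs_nonneg _) ?_
      exact_mod_cast norm_fderiv_le_of_lipschitz ℝ (lipschitzWith_one_norm (E := Eu n)) (x₀ := x)

/-- A trapezoidal cutoff on `[0, 1]`. -/
noncomputable def trapezoid (θ s : ℝ) : ℝ :=
  max 0 (min 1 (min ((s - θ) / θ) ((1 - θ - s) / θ)))

theorem continuous_trapezoid (θ : ℝ) : Continuous (trapezoid θ) := by
  unfold trapezoid
  fun_prop

theorem trapezoid_nonneg (θ s : ℝ) : 0 ≤ trapezoid θ s := le_max_left _ _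

theorem trapezoid_le_one (θ s : ℝ) : trapezoid θ s ≤ 1 :=
  max_le zero_le_one (min_le_left _ _)

theorem trapezoid_of_le {θ s : ℝ} (hθ : 0 < θ) (hs : s ≤ θ) : trapezoid θ s = 0 := by
  apply max_eq_left
  refine (min_le_right _ _).trans ((min_le_left _ _).trans ?_)
  exact div_nonpos_of_nonpos_of_nonneg (by linarith) hθ.le

theorem trapezoid_of_ge {θ s : ℝ} (hθ : 0 < θ) (hs : 1 - θ ≤ s) : trapezoid θ s = 0 := by
  apply max_eq_left
  refine (min_le_right _ _).trans ((min_le_right _ _).trans ?_)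
  exact div_nonpos_of_nonpos_of_nonneg (by linarith) hθ.le

theorem trapezoid_eq_one {θ s : ℝ} (hθ : 0 < θ) (h1 : 2 * θ ≤ s) (h2 : s ≤ 1 - 2 * θ) :
    trapezoid θ s = 1 := by
  unfold trapezoid
  have e1 : 1 ≤ (s - θ) / θ := by rw [le_div_iff₀ hθ]; linarith
  have e2 : 1 ≤ (1 - θ - s) / θ := by rw [le_div_iff₀ hθ]; linarith
  rw [min_eq_left (le_min e1 e2), max_eq_right zero_le_one]

/-- Minus the radial derivative of the smoothed Moser function. -/
noncomputable def moserSlope (β L θ r : ℝ) : ℝ :=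
  (max (-Real.log (max r (Real.exp (-L)))) (θ * L)) ^ (-β) *
    trapezoid θ (-Real.log (max r (Real.exp (-L))) / L) / max r (Real.exp (-L))

theorem continuous_moserSlope {β L θ : ℝ} (hL : 0 < L) (hθ : 0 < θ) :
    Continuous (moserSlope β L θ) := by
  have hpos : ∀ r : ℝ, 0 < max r (Real.exp (-L)) := fun r => lt_max_of_lt_right (Real.exp_pos _)
  have hm : Continuous fun r : ℝ => max r (Real.exp (-L)) := by fun_prop
  have hl : Continuous fun r : ℝ => -Real.log (max r (Real.exp (-L))) :=
    (hm.log fun r => (hpos r).ne').neg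
  unfold moserSlope
  refine Continuous.div (Continuous.mul ?_ ?_) hm fun r => (hpos r).ne'
  · refine (hl.max continuous_const).rpow_const fun r => Or.inl ?_
    exact (lt_max_of_lt_right (by positivity)).ne'
  · exact (continuous_trapezoid θ).comp (hl.div_const L)

theorem moserSlope_nonneg {β L θ : ℝ} (hL : 0 < L) (hθ : 0 < θ) (r : ℝ) :
    0 ≤ moserSlope β L θ r := by
  have hpos : 0 < max r (Real.exp (-L)) := lt_max_of_lt_right (Real.exp_pos _)
  have h2 : 0 < max (-Real.log (max r (Real.exp (-L)))) (θ * L) :=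
    lt_max_of_lt_right (by positivity)
  have := trapezoid_nonneg θ (-Real.log (max r (Real.exp (-L))) / L)
  unfold moserSlope
  positivity

theorem moserSlope_of_le {β L θ r : ℝ} (hL : 0 < L) (hθ : 0 < θ)
    (hr : r ≤ Real.exp (-((1 - θ) * L))) : moserSlope β L θ r = 0 := by
  have hm : max r (Real.exp (-L)) ≤ Real.exp (-((1 - θ) * L)) := by
    apply max_le hr
    apply Real.exp_le_exp.2
    nlinarith
  have hpos : 0 < max r (Real.exp (-L)) := lt_max_of_lt_right (Real.exp_pos _)
  have := (Real.log_le_iff_le_exp hpos).2 hm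
  rw [moserSlope, trapezoid_of_ge hθ, mul_zero, zero_div]
  rw [le_div_iff₀ hL]
  linarith

theorem moserSlope_of_ge {β L θ r : ℝ} (hL : 0 < L) (hθ : 0 < θ)
    (hr : Real.exp (-(θ * L)) ≤ r) : moserSlope β L θ r = 0 := by
  have hm : Real.exp (-(θ * L)) ≤ max r (Real.exp (-L)) := hr.trans (le_max_left _ _)
  have hpos : 0 < max r (Real.exp (-L)) := lt_max_of_lt_right (Real.exp_pos _)
  have := (Real.le_log_iff_exp_le hpos).2 hm
  rw [moserSlope, trapezoid_of_le hθ, mul_zero, zero_div]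
  rw [div_le_iff₀ hL]
  linarith

theorem moserSlope_le {β L θ r : ℝ} (hL : 0 < L) (hθ : 0 < θ)
    (h1 : Real.exp (-((1 - θ) * L)) ≤ r) (h2 : r ≤ Real.exp (-(θ * L))) :
    moserSlope β L θ r ≤ (-Real.log r) ^ (-β) / r := by
  have hr : 0 < r := (Real.exp_pos _).trans_le h1
  have hm : max r (Real.exp (-L)) = r := by
    apply max_eq_left
    refine le_trans (Real.exp_le_exp.2 ?_) h1
    nlinarith
  have hl := (Real.log_le_iff_le_exp hr).2 h2
  have hl2 : θ * L ≤ -Real.log r := by linarith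
  have : 0 < -Real.log r := lt_of_lt_of_le (by positivity) hl2
  rw [moserSlope, hm, max_eq_left hl2]
  gcongr
  exact mul_le_of_le_one_right (by positivity) (trapezoid_le_one _ _)

theorem moserSlope_eq {β L θ r : ℝ} (hL : 0 < L) (hθ : 0 < θ)
    (h1 : Real.exp (-((1 - 2 * θ) * L)) ≤ r) (h2 : r ≤ Real.exp (-(2 * θ * L))) :
    moserSlope β L θ r = (-Real.log r) ^ (-β) / r := by
  have hr : 0 < r := (Real.exp_pos _).trans_le h1
  have hθL : 0 < θ * L := by positivity
  have hm : max r (Real.exp (-L)) = r := by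
    apply max_eq_left
    refine le_trans (Real.exp_le_exp.2 ?_) h1
    nlinarith
  have hl := (Real.log_le_iff_le_exp hr).2 h2
  have hl' := (Real.le_log_iff_exp_le hr).2 h1
  rw [moserSlope, hm, max_eq_left (by linarith), trapezoid_eq_one hθ, mul_one]
  · rw [le_div_iff₀ hL]; linarith
  · rw [div_le_iff₀ hL]; linarith

/-- The smoothed Moser functions are admissible and nearly extremal near the origin. -/
theorem exists_admissible_large {n : ℕ} {β : ℝ} (hβ₁ : β < 1) {L θ : ℝ}
    (hL : 0 < L) (hθ : 0 < θ) (hθ4 : θ < 1 / 4) :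
    ∃ u ∈ admissible (n + 1) β, ∀ x : Eu n, ‖x‖ < Real.exp (-L) →
      ((1 - 2 * θ) ^ (1 - β) - (2 * θ) ^ (1 - β)) *
        (((1 - β) / (surfaceArea (n + 1) * L ^ (1 - β))) ^ (((n : ℝ) + 1)⁻¹) *
          (L ^ (1 - β) / (1 - β))) ≤ u x := by
  have hσ := surfaceArea_pos n
  have hβ' : 0 < 1 - β := by linarith
  set σ := surfaceArea (n + 1)
  set k : ℝ := ((1 - β) / (σ * L ^ (1 - β))) ^ (((n : ℝ) + 1)⁻¹) with hk
  have hk0 : 0 < k := by positivity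
  have hkpow : k ^ (n + 1) = (1 - β) / (σ * L ^ (1 - β)) := by
    have := Real.rpow_inv_natCast_pow (x := (1 - β) / (σ * L ^ (1 - β))) (by positivity)
      (Nat.succ_ne_zero n)
    push_cast at this
    exact this
  set η : ℝ → ℝ := fun r => k * moserSlope β L θ r with hη
  have hηc : Continuous η := continuous_const.mul (continuous_moserSlope hL hθ)
  have hη0 : ∀ r, 0 ≤ η r := fun r => mul_nonneg hk0.le (moserSlope_nonneg hL hθ r)
  set V : ℝ → ℝ := fun r => ∫ s in r..1, η s with hV
  have hVd : ∀ r, HasDerivAt V (-η r) r := fun r =>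
    intervalIntegral.integral_hasDerivAt_left (hηc.intervalIntegrable _ _)
      (hηc.stronglyMeasurableAtFilter _ _) hηc.continuousAt
  set ρ : ℝ := Real.exp (-((1 - θ) * L)) with hρ
  set τ : ℝ := Real.exp (-(θ * L)) with hτ
  have hρ0 : 0 < ρ := Real.exp_pos _
  have hθL : 0 < θ * L := by positivity
  have hτ1 : τ < 1 := by rw [hτ, Real.exp_lt_one_iff]; linarith
  have hρτ : ρ ≤ τ := by apply Real.exp_le_exp.2; nlinarith
  have hVconst : ∀ r < ρ, V r = V 0 := by
    intro r hr
    have hz : ∫ s in r..0, η s = 0 := by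
      apply intervalIntegral.integral_zero_ae
      refine Eventually.of_forall fun s hs => ?_
      have : s ≤ ρ := hs.2.trans (max_le hr.le hρ0.le)
      rw [hη]
      simp only
      rw [moserSlope_of_le hL hθ this, mul_zero]
    have := intervalIntegral.integral_add_adjacent_intervals (a := r) (b := 0) (c := 1)
      (hηc.intervalIntegrable (μ := volume) _ _) (hηc.intervalIntegrable _ _)
    rw [hz, zero_add] at this
    exact this.symm
  have hVzero : ∀ r, τ ≤ r → V r = 0 := by
    intro r hr
    apply intervalIntegral.integral_zero_ae
    refine Eventually.of_forall fun s hs => ?_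
    have : τ ≤ s := (le_min hr hτ1.le).trans hs.1.le
    rw [hη]
    simp only
    rw [moserSlope_of_ge hL hθ this, mul_zero]
  obtain ⟨hu1, hugrad⟩ := contDiff_comp_norm (n := n) hηc hVd hρ0 hVconst
  set u : Eu n → ℝ := fun x => V ‖x‖ with hu
  have hsupp : tsupport u ⊆ Metric.closedBall (0 : Eu n) τ := by
    apply closure_minimal _ Metric.isClosed_closedBall
    intro x hx
    by_contra hx'
    rw [mem_closedBall_zero_iff, not_le] at hx'
    exact hx (hVzero _ hx'.le)
  have huC : IsC1c (n + 1) u := by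
    refine ⟨hu1, ?_, hsupp.trans (Metric.closedBall_subset_ball hτ1)⟩
    exact HasCompactSupport.of_support_subset_isCompact (isCompact_closedBall (0 : Eu n) τ)
      (subset_closure.trans hsupp)
  have hnorm : weightedNorm (n + 1) β (gradient u) ^ (n + 1) ≤ 1 := by
    rw [← lintegral_rayEnergy hu1]
    have hray : ∀ θ' : Metric.sphere (0 : Eu n) 1, rayEnergy n β u θ'.1 (Set.Ioo 0 1) ≤
        ENNReal.ofReal (k ^ (n + 1)) *
          ENNReal.ofReal (((-Real.log ρ) ^ (1 - β) - (-Real.log τ) ^ (1 - β)) / (1 - β)) := by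
      intro θ'
      rw [← lintegral_neg_log_rpow_div hβ₁ hρ0 hρτ hτ1,
        ← lintegral_const_mul' _ _ ENNReal.ofReal_ne_top, rayEnergy,
        ← lintegral_indicator measurableSet_Ioo, ← lintegral_indicator measurableSet_Ioo]
      refine lintegral_mono fun r => ?_
      by_cases hr : r ∈ Set.Ioo (0 : ℝ) 1
      · have hr0 := hr.1
        have hl : 0 < -Real.log r := by linarith [Real.log_neg hr.1 hr.2]
        rw [Set.indicator_of_mem hr]
        have hg : ‖gradient u (r • θ'.1)‖ ≤ η r := by
          refine (hugrad _).trans (le_of_eq ?_)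
          have : ‖r • θ'.1‖ = r := by simp [norm_smul, abs_of_pos hr0]
          rw [this, abs_of_nonneg (hη0 r)]
        have hge : ‖gradient u (r • θ'.1)‖ₑ ≤ ENNReal.ofReal (η r) := by
          rw [← ofReal_norm]
          exact ENNReal.ofReal_le_ofReal hg
        by_cases hr' : r ∈ Set.Ioo ρ τ
        · rw [Set.indicator_of_mem hr', ← ENNReal.ofReal_mul (by positivity)]
          refine (mul_le_mul_right (pow_le_pow_left₀ zero_le hge (n + 1)) _).trans ?_
          rw [← ENNReal.ofReal_pow (hη0 r), ← ENNReal.ofReal_mul (by positivity)]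
          apply ENNReal.ofReal_le_ofReal
          have hs := moserSlope_le (β := β) hL hθ hr'.1.le hr'.2.le
          calc r ^ n * (-Real.log r) ^ (β * n) * (k * moserSlope β L θ r) ^ (n + 1)
              ≤ r ^ n * (-Real.log r) ^ (β * n) * (k * ((-Real.log r) ^ (-β) / r)) ^ (n + 1) := by
                gcongr
                exact hη0 r
            _ = k ^ (n + 1) * ((-Real.log r) ^ (-β) / r) := by
                rw [Real.rpow_mul_natCast hl.le, Real.rpow_neg hl.le]
                have hT : 0 < (-Real.log r) ^ β := by positivity
                rw [show k * (((-Real.log r) ^ β)⁻¹ / r) = k / ((-Real.log r) ^ β * r) by field_simp,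
                  div_pow, mul_pow]
                field_simp
                ring
        · have hz : η r = 0 := by
            rw [hη]
            simp only
            rw [Set.mem_Ioo, not_and_or, not_lt, not_lt] at hr'
            rcases hr' with h | h
            · rw [moserSlope_of_le hL hθ h, mul_zero]
            · rw [moserSlope_of_ge hL hθ h, mul_zero]
          rw [hz, ENNReal.ofReal_zero] at hge
          rw [le_zero_iff.1 hge]
          simp
      · rw [Set.indicator_of_notMem hr]
        exact zero_le
    refine (lintegral_mono hray).trans ?_
    rw [lintegral_const, toSphere_univ_eq, ← ENNReal.ofReal_mul (by positivity),
      ← ENNReal.ofReal_mul' hσ.le]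
    rw [ENNReal.ofReal_le_one, hkpow, hρ, hτ, Real.log_exp, Real.log_exp, neg_neg, neg_neg]
    have h1 : ((1 - θ) * L) ^ (1 - β) ≤ L ^ (1 - β) := by
      apply Real.rpow_le_rpow _ _ hβ'.le <;> nlinarith
    have h2 : 0 ≤ (θ * L) ^ (1 - β) := by positivity
    calc (1 - β) / (σ * L ^ (1 - β)) * ((((1 - θ) * L) ^ (1 - β) - (θ * L) ^ (1 - β)) / (1 - β)) * σ
        ≤ (1 - β) / (σ * L ^ (1 - β)) * (L ^ (1 - β) / (1 - β)) * σ := by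
          gcongr
          linarith
      _ = 1 := by field_simp
  refine ⟨u, ⟨⟨V, Eventually.of_forall fun x => rfl⟩, gradient u, memW0_of_isC1c huC, ?_⟩, ?_⟩
  · by_contra! h
    exact absurd hnorm (not_le.2 (one_lt_pow₀ h (Nat.succ_ne_zero n)))
  · intro x hx
    have hVx : u x = V 0 := by
      apply hVconst
      refine hx.trans_le (Real.exp_le_exp.2 ?_)
      nlinarith
    rw [hVx]
    set a : ℝ := Real.exp (-((1 - 2 * θ) * L)) with ha
    set b : ℝ := Real.exp (-(2 * θ * L)) with hb
    have hab : a ≤ b := by apply Real.exp_le_exp.2; nlinarith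
    have hb1 : b < 1 := by rw [hb, Real.exp_lt_one_iff]; linarith
    have ha0 : 0 < a := Real.exp_pos _
    have hint : ∫ s in a..b, η s ≤ V 0 := by
      apply intervalIntegral.integral_mono_interval ha0.le hab hb1.le
      · exact Eventually.of_forall hη0
      · exact hηc.intervalIntegrable _ _
    refine le_trans (le_of_eq ?_) hint
    have hcongr : ∫ s in a..b, η s = ∫ s in a..b, k * ((-Real.log s) ^ (-β) / s) := by
      apply intervalIntegral.integral_congr
      intro s hs
      rw [Set.uIcc_of_le hab] at hs
      simp only [hη]
      rw [moserSlope_eq hL hθ hs.1 hs.2]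
    rw [hcongr, intervalIntegral.integral_const_mul, integral_neg_log_rpow_div hβ₁ ha0 hab hb1, ha,
      hb, Real.log_exp, Real.log_exp, neg_neg, neg_neg, Real.mul_rpow (by linarith) hL.le,
      Real.mul_rpow (by positivity) hL.le]
    ring

theorem moser_value_rpow {n : ℕ} (hn : 1 ≤ n) {σ β s : ℝ} (hσ : 0 < σ) (hβ₁ : β < 1) (hs : 0 < s) :
    (((1 - β) / (σ * s)) ^ (((n : ℝ) + 1)⁻¹) * (s / (1 - β))) ^ (((n : ℝ) + 1) / n) =
      s / (σ ^ (1 / (n : ℝ)) * (1 - β)) := by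
  have hn' : (1 : ℝ) ≤ n := by exact_mod_cast hn
  have hβ' : 0 < 1 - β := by linarith
  rw [Real.mul_rpow (by positivity) (by positivity), ← Real.rpow_mul (by positivity),
    show ((n : ℝ) + 1)⁻¹ * ((n + 1) / n) = 1 / n by field_simp,
    show ((n : ℝ) + 1) / n = 1 + 1 / n by field_simp,
    Real.rpow_add (by positivity), Real.rpow_one, mul_left_comm,
    ← Real.mul_rpow (by positivity) (by positivity),
    show (1 - β) / (σ * s) * (s / (1 - β)) = σ⁻¹ by field_simp, Real.inv_rpow hσ.le]
  field_simp

/-- Above the critical exponent the supremum is infinite. -/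
theorem moserSup_Y1_eq_top {n : ℕ} (hn : 1 ≤ n) {β : ℝ} (hβ₀ : 0 < β) (hβ₁ : β < 1) {α : ℝ}
    (hα : criticalExponent (n + 1) β < α) : moserSup (n + 1) β α Y1 = ⊤ := by
  have hn' : (1 : ℝ) ≤ n := by exact_mod_cast hn
  have hσ := surfaceArea_pos n
  have hβ' : 0 < 1 - β := by linarith
  set σ := surfaceArea (n + 1) with hσdef
  set A : ℝ := σ ^ (1 / (n : ℝ)) * (1 - β) with hA
  have hA0 : 0 < A := by positivity
  rw [criticalExponent_succ, ← hσdef, ← hA] at hα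
  have hα0 : 0 < α := lt_trans (by positivity) hα
  set p : ℝ := ((n : ℝ) + 1) / n with hp
  have hp0 : 0 < p := by positivity
  set c : ℝ → ℝ := fun θ => (1 - 2 * θ) ^ (1 - β) - (2 * θ) ^ (1 - β) with hc
  have hclim : Tendsto (fun θ => α / A * (c θ) ^ p - (n + 1)) (𝓝[>] 0)
      (𝓝 (α / A * 1 - (n + 1))) := by
    have hcont : ContinuousAt (fun θ => α / A * (c θ) ^ p - (n + 1)) 0 := by
      have hcc : Continuous c := by
        refine Continuous.sub ?_ ?_
        · exact Continuous.rpow_const (by fun_prop) fun _ => Or.inr hβ'.le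
        · exact Continuous.rpow_const (by fun_prop) fun _ => Or.inr hβ'.le
      exact ((continuous_const.mul (hcc.rpow_const fun _ => Or.inr hp0.le)).sub
        continuous_const).continuousAt
    have := hcont.tendsto
    simp only [hc, mul_zero, sub_zero, Real.one_rpow, Real.zero_rpow hβ'.ne'] at this
    rw [mul_one] at this ⊢
    exact this.mono_left nhdsWithin_le_nhds
  have hlimpos : 0 < α / A * 1 - (n + 1) := by
    rw [mul_one, sub_pos, lt_div_iff₀ hA0]
    exact hα
  have hsmall : ∀ᶠ θ : ℝ in 𝓝[>] 0, 0 < θ ∧ θ < 1 / 4 :=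
    Ioo_mem_nhdsGT (by norm_num)
  obtain ⟨θ, hδ, hθ0, hθ4'⟩ := ((hclim.eventually (lt_mem_nhds hlimpos)).and hsmall).exists
  set δ : ℝ := α / A * (c θ) ^ p - (n + 1) with hδdef
  have hc0 : 0 ≤ c θ := by
    rw [hc, sub_nonneg]
    apply Real.rpow_le_rpow (by linarith) (by linarith) hβ'.le
  have hlow : ∀ L : ℝ, 0 < L → ENNReal.ofReal (Real.exp (δ * L)) ≤ moserSup (n + 1) β α Y1 := by
    intro L hL
    obtain ⟨u, hu, hux⟩ := exists_admissible_large (n := n) (β := β) hβ₁ hL hθ0 hθ4'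
    refine le_trans ?_ (le_iSup₂ (f := fun u (_ : u ∈ admissible (n + 1) β) =>
      ⨍⁻ x in unitBall (n + 1), ENNReal.ofReal (Real.exp (α * |u x| ^
        (((n + 1 : ℕ) : ℝ) / (((n + 1 : ℕ) : ℝ) - 1)) * Y1 ‖x‖ ^ (-β))) ∂volume) u hu)
    have hv0 : volume (unitBall (n + 1)) ≠ 0 := (Metric.measure_ball_pos volume _ one_pos).ne'
    have hvt : volume (unitBall (n + 1)) ≠ ⊤ := measure_ball_lt_top.ne
    rw [setLAverage_eq, ENNReal.le_div_iff_mul_le (Or.inl hv0) (Or.inl hvt)]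
    have hsub : Metric.ball (0 : Eu n) (Real.exp (-L)) ⊆ unitBall (n + 1) :=
      Metric.ball_subset_ball (by rw [Real.exp_le_one_iff]; linarith)
    refine le_trans ?_ (lintegral_mono_set hsub)
    have hpt : ∀ᵐ x ∂(volume.restrict (Metric.ball (0 : Eu n) (Real.exp (-L)))),
        ENNReal.ofReal (Real.exp ((δ + (n + 1)) * L)) ≤ ENNReal.ofReal (Real.exp (α * |u x| ^
          (((n + 1 : ℕ) : ℝ) / (((n + 1 : ℕ) : ℝ) - 1)) * Y1 ‖x‖ ^ (-β))) := by
      have h0 : ∀ᵐ x ∂(volume.restrict (Metric.ball (0 : Eu n) (Real.exp (-L)))), x ≠ 0 :=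
        ae_restrict_of_ae (Measure.ae_ne volume 0)
      filter_upwards [h0, ae_restrict_mem Metric.isOpen_ball.measurableSet] with x hx0 hxb
      have hxpos : 0 < ‖x‖ := norm_pos_iff.2 hx0
      have hxL : ‖x‖ < Real.exp (-L) := by simpa using hxb
      have hx1 : ‖x‖ < 1 := hxL.trans_le (by rw [Real.exp_le_one_iff]; linarith)
      have hlog : L ≤ -Real.log ‖x‖ := by
        have := (Real.log_le_iff_le_exp hxpos).2 hxL.le
        linarith
      apply ENNReal.ofReal_le_ofReal
      apply Real.exp_le_exp.2
      rw [Y1_rpow_neg hxpos hx1]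
      push_cast
      rw [add_sub_cancel_right, ← hp]
      set v : ℝ := ((1 - β) / (σ * L ^ (1 - β))) ^ (((n : ℝ) + 1)⁻¹) * (L ^ (1 - β) / (1 - β))
        with hv
      have hv0 : 0 ≤ v := by positivity
      have hle : c θ * v ≤ |u x| := (hux x hxL).trans (le_abs_self _)
      have hvp : v ^ p = L ^ (1 - β) / A := moser_value_rpow hn hσ hβ₁ (by positivity)
      calc (δ + (n + 1)) * L = α * ((c θ) ^ p * v ^ p) * L ^ β := by
            rw [hvp, hδdef, Real.rpow_sub hL, Real.rpow_one]
            have : 0 < L ^ β := by positivity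
            field_simp
            ring
        _ = α * (c θ * v) ^ p * L ^ β := by rw [Real.mul_rpow hc0 hv0]
        _ ≤ _ := by gcongr
    refine le_trans (le_of_eq ?_) (lintegral_mono_ae hpt)
    rw [lintegral_const, Measure.restrict_apply_univ,
      Measure.addHaar_ball_of_pos _ _ (Real.exp_pos _), ← mul_assoc,
      ← ENNReal.ofReal_mul (Real.exp_pos _).le]
    congr 2
    rw [finrank_euclideanSpace_fin, ← Real.exp_nat_mul, ← Real.exp_add]
    congr 1
    push_cast
    ring
  refine ENNReal.eq_top_of_forall_nnreal_le fun K => ?_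
  have hK : (K : ℝ≥0∞) < ENNReal.ofReal (Real.exp (δ * ((K + 1) / δ))) := by
    rw [mul_div_cancel₀ _ hδ.ne', ENNReal.lt_ofReal_iff_toReal_lt ENNReal.coe_ne_top,
      ENNReal.coe_toReal]
    linarith [Real.add_one_le_exp ((K : ℝ) + 1)]
  exact hK.le.trans (hlow _ (by positivity))

theorem moserSup_Y1_le_X1 {n : ℕ} {β α : ℝ} (hβ₀ : 0 < β) (hα : 0 ≤ α) :
    moserSup (n + 1) β α Y1 ≤ moserSup (n + 1) β α X1 := by
  refine iSup₂_mono fun u _ => ?_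
  rw [setLAverage_eq, setLAverage_eq]
  gcongr ?_ / _
  apply lintegral_mono_ae
  have h0 : ∀ᵐ x ∂(volume.restrict (unitBall (n + 1))), x ≠ 0 :=
    ae_restrict_of_ae (Measure.ae_ne volume 0)
  filter_upwards [h0, ae_restrict_mem Metric.isOpen_ball.measurableSet] with x hx0 hxb
  have hx1 : ‖x‖ < 1 := by simpa [unitBall] using hxb
  have hxpos : 0 < ‖x‖ := norm_pos_iff.2 hx0
  have hl : 0 < -Real.log ‖x‖ := by linarith [Real.log_neg hxpos hx1]
  rw [X1_rpow_neg hxpos hx1, Y1_rpow_neg hxpos hx1]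
  gcongr
  linarith

theorem theorem1p7 (N : ℕ) (hN : 2 ≤ N) (β : ℝ) (hβ₀ : 0 < β) (hβ₁ : β < 1) :
    (∀ α : ℝ, moserSup N β α X1 < ⊤ ↔ α ≤ criticalExponent N β) ∧
      (∀ α : ℝ, criticalExponent N β < α → moserSup N β α Y1 = ⊤) := by
  obtain ⟨n, rfl⟩ : ∃ n, N = n + 1 := ⟨N - 1, by omega⟩
  have hn : 1 ≤ n := by omega
  refine ⟨fun α => ⟨fun h => ?_, moserSup_X1_lt_top hn hβ₀ hβ₁⟩,
    fun α hα => moserSup_Y1_eq_top hn hβ₀ hβ₁ hα⟩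
  by_contra! hα
  have hβ' : 0 < 1 - β := by linarith
  have hσ := surfaceArea_pos n
  have hα0 : 0 ≤ α := by
    refine le_trans ?_ hα.le
    rw [criticalExponent_succ]
    positivity
  have := moserSup_Y1_le_X1 (n := n) hβ₀ hα0
  rw [moserSup_Y1_eq_top hn hβ₀ hβ₁ hα] at this
  exact absurd h (not_lt.2 this)
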